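/- For $\tau$ in the upper half-plane let $q=e^{2\pi i\tau}$, $P(q)=1-24\sum_{j=1}^{\infty}\frac{jq^{j}}{1-q^{j}}$ and $P_\ell=P(q^\ell)$. Let $\eta(\tau)=q^{1/24}\prod_{j=1}^{\infty}(1-q^{j})$, where $q^{1/24}=e^{2\pi i\tau/24}$, let $\eta_\ell=\eta(\ell\tau)$, and put $$z=\eta_2^2\eta_{10}^2,\qquad u=\left(\frac{\eta_1\eta_{20}}{\eta_4\eta_5}\right)^2,\qquad v=\left(\frac{\eta_2\eta_5\eta_{20}}{\eta_1\eta_4\eta_{10}}\right)^2 .$$ Then, for every $\tau$ in the upper half-plane, \begin{align*} zu&=\frac{1}{72}\left(P_{1}-6P_{2}+20P_{4}-25P_{5}+30P_{10}-20P_{20}\right)+\frac{1}{3}z,\\ \frac{z}{u}&=\frac{1}{72}\left(-5P_{1}+6P_{2}-4P_{4}+5P_{5}-30P_{10}+100P_{20}\right)+\frac{1}{3}z,\\ zv&=\frac{1}{72}\left(-P_{1}+4P_{4}+P_{5}-4P_{20}\right)-\frac{1}{3}z,\\ \frac{z}{v}&=\frac{1}{72}\left(P_{1}-4P_{4}-25P_{5}+100P_{20}\right)-\frac{5}{3}z.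 \end{align*} -/

import Mathlib

noncomputable section

namespace Level20

/-- The nome `q = e^{2πiτ}`. -/
def nome (τ : ℂ) : ℂ := Complex.exp (2 * (Real.pi : ℂ) * Complex.I * τ)

/-- Ramanujan's weight two Eisenstein series
`P(q) = 1 - 24 ∑_{j ≥ 1} j q^j / (1 - q^j)`, for `|q| < 1`
(the index `j` below is shifted by one). -/
def P (q : ℂ) : ℂ :=
  1 - 24 * ∑' j : ℕ, ((j + 1 : ℕ) : ℂ) * q ^ (j + 1) / (1 - q ^ (j + 1))

/-- `η_ℓ(τ) = η(ℓτ)`, where `η(τ) = q^{1/24} ∏_{j ≥ 1} (1 - q^j)` is the Dedekind eta function. -/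
def etaAt (l : ℕ) (τ : ℂ) : ℂ := ModularForm.eta ((l : ℂ) * τ)

/-- `P_ℓ = P(q^ℓ)` as a function of `τ`. -/
def PAt (l : ℕ) (τ : ℂ) : ℂ := P (nome τ ^ l)

/-- `u = (η_1 η_20 / (η_4 η_5))^2`. -/
def u (τ : ℂ) : ℂ := (etaAt 1 τ * etaAt 20 τ / (etaAt 4 τ * etaAt 5 τ)) ^ 2

/-- `v = (η_2 η_5 η_20 / (η_1 η_4 η_10))^2`. -/
def v (τ : ℂ) : ℂ :=
  (etaAt 2 τ * etaAt 5 τ * etaAt 20 τ / (etaAt 1 τ * etaAt 4 τ * etaAt 10 τ)) ^ 2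

/-- The cusp form `z = η_2^2 η_10^2`. -/
def z (τ : ℂ) : ℂ := etaAt 2 τ ^ 2 * etaAt 10 τ ^ 2

end Level20

end

/-! With $\varphi(q)=\sum q^{n^2}$, everything is expressed through $\varphi(q)^2$ and
$\varphi(q^5)^2$. Grouping the Gaussian integers by residue modulo $2+i$ and applying the triple
product writes $\varphi(q)^2-\varphi(q^5)^2$ as an eta quotient $4X$ (`eta_identity_sub`). The
Fricke involution $\tau\mapsto-1/(20\tau)$ turns this into $5\varphi(q^5)^2-\varphi(q)^2=4Y$. Hence
$\varphi(q)^2=5X+Y$ and $\varphi(q^5)^2=X+Y$, while $X^2=zv$, $Y^2=z/v$ and $XY=z$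
(`exists_parametrization`).

The four squares identity $4P_4-P_1=3\varphi(q)^4$ (`eisenstein_eq_phi_pow`), at $\tau$ and $5\tau$,
gives two linear equations for $X^2$ and $Y^2$ modulo $XY=z$; these are the formulas for $zv$ and
$z/v$. It is proved from a Wronskian of two theta series that equals $2\prod(1-q^j)^6$, by Jacobi's
formula for the cube.

For $u$, the sum $zu+z/u$ comes from $u+1/u=1/v+5v+4$ (`u_v_relation`), a factor of a polynomial
relation among eta quotients. The difference $z/u-zu$ is, up to $2\pi i$, the logarithmic derivative
of $v$ (`eisenstein_eq_z_u`): differentiate that relation, using that the logarithmic derivative of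
$u$ is $2\pi i(z/v-5zv)$. Superfluous factors are cancelled because holomorphic functions on the
half-plane have no zero divisors. -/

noncomputable section

namespace Level20

open Filter Topology Finset

/-! ### Gaussian binomials and the Jacobi triple product. -/

/-- The Gaussian binomial coefficients. -/
def gaussBinom (q : ℂ) : ℕ → ℕ → ℂ
  | _, 0 => 1
  | 0, _ + 1 => 0
  | n + 1, k + 1 => gaussBinom q n k + q ^ (k + 1) * gaussBinom q n (k + 1)

@[simp] lemma gaussBinom_zero_right (q : ℂ) (n : ℕ) : gaussBinom q n 0 = 1 := by
  cases n <;> rfl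

lemma gaussBinom_eq_zero (q : ℂ) {n k : ℕ} (h : n < k) : gaussBinom q n k = 0 := by
  induction n generalizing k with
  | zero => obtain ⟨k, rfl⟩ := Nat.exists_eq_succ_of_ne_zero h.ne'; rfl
  | succ n ih =>
    obtain ⟨k, rfl⟩ := Nat.exists_eq_succ_of_ne_zero (by omega : k ≠ 0)
    simp [gaussBinom, ih (by omega : n < k), ih (by omega : n < k + 1)]

/-- The finite `q`-binomial theorem. -/
lemma prod_one_add_mul_pow (q y : ℂ) (n : ℕ) :
    ∏ j ∈ range n, (1 + y * q ^ j) =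
      ∑ k ∈ range (n + 1), gaussBinom q n k * q ^ (k.choose 2) * y ^ k := by
  induction n generalizing y with
  | zero => simp
  | succ n ih =>
    have h : ∏ j ∈ range n, (1 + y * q ^ (j + 1)) =
        ∑ k ∈ range (n + 1), gaussBinom q n k * q ^ (k.choose 2) * (y * q) ^ k := by
      rw [← ih]; exact prod_congr rfl fun j _ ↦ by ring
    rw [prod_range_succ', h, sum_range_succ' _ (n + 1)]
    have h2 : ∑ k ∈ range (n + 1), gaussBinom q n k * q ^ (k.choose 2) * (y * q) ^ k =
        ∑ k ∈ range (n + 1), gaussBinom q n (k + 1) * q ^ ((k + 1).choose 2) * (y * q) ^ (k + 1)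
          + 1 := by
      rw [sum_range_succ' _ n, sum_range_succ _ n, gaussBinom_eq_zero q (Nat.lt_succ_self n)]
      simp
    rw [pow_zero, mul_one, mul_add, mul_one]
    nth_rw 1 [h2]
    rw [sum_mul, add_right_comm, ← sum_add_distrib]
    congr 1
    · refine sum_congr rfl fun k _ ↦ ?_
      rw [gaussBinom, Nat.choose_succ_succ' k 1, Nat.choose_one_right]
      ring
    · simp

/-- The finite product `(1 - q)(1 - q²)⋯(1 - qⁿ)`. -/
def qFactorial (q : ℂ) (n : ℕ) : ℂ := ∏ j ∈ range n, (1 - q ^ (j + 1))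

/-- The factorial formula without division, so that roots of unity need no exception. The two Pascal
terms recombine through $1-q^{a+b+2}=(1-q^{a+1})+q^{a+1}(1-q^{b+1})$. -/
lemma gaussBinom_mul (q : ℂ) (a b : ℕ) :
    gaussBinom q (a + b) a * (qFactorial q a * qFactorial q b) = qFactorial q (a + b) := by
  induction h : a + b generalizing a b with
  | zero =>
    obtain ⟨rfl, rfl⟩ : a = 0 ∧ b = 0 := by omega
    simp [qFactorial]
  | succ n ih =>
    rcases a with _ | a
    · simp at h; subst h; simp [qFactorial]
    rcases b with _ | b
    · obtain rfl : a = n := by omega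
      have := ih a 0 (by omega)
      rw [gaussBinom, gaussBinom_eq_zero q (Nat.lt_succ_self a)]
      simp only [qFactorial, prod_range_succ, range_zero, prod_empty] at *
      linear_combination (1 - q ^ (a + 1)) * this
    · have h1 := ih a (b + 1) (by omega)
      have h2 := ih (a + 1) b (by omega)
      rw [gaussBinom]
      obtain rfl : n = a + b + 1 := by omega
      simp only [qFactorial, prod_range_succ] at *
      linear_combination (1 - q ^ (a + 1)) * h1 + q ^ (a + 1) * (1 - q ^ (b + 1)) * h2

/-- Euler's product `∏_{j ≥ 1} (1 - q^j)`. -/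
def euler (q : ℂ) : ℂ := ∏' n : ℕ, (1 - q ^ (n + 1))

lemma one_sub_pow_ne_zero {q : ℂ} (hq : ‖q‖ < 1) (n : ℕ) : 1 - q ^ (n + 1) ≠ 0 := by
  intro h
  have := pow_lt_one₀ (norm_nonneg q) hq n.succ_ne_zero
  rw [← norm_pow, ← sub_eq_zero.mp h] at this
  simp at this

lemma summable_norm_pow_succ {q : ℂ} (hq : ‖q‖ < 1) : Summable fun n : ℕ ↦ ‖q ^ (n + 1)‖ := by
  simpa using (summable_nat_add_iff 1).mpr (summable_geometric_of_lt_one (norm_nonneg _) hq)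

lemma multipliable_one_add_mul_pow {q : ℂ} (hq : ‖q‖ < 1) (y : ℂ) :
    Multipliable fun n : ℕ ↦ 1 + y * q ^ n :=
  multipliable_one_add_of_summable <| by
    simpa using (summable_geometric_of_lt_one (norm_nonneg _) hq).mul_left ‖y‖

lemma multipliable_one_add_mul_pow_odd {r : ℂ} (hr : ‖r‖ < 1) (y : ℂ) :
    Multipliable fun n : ℕ ↦ 1 + y * r ^ (2 * n + 1) := by
  refine (multipliable_one_add_mul_pow (q := r ^ 2) (y := y * r) ?_).congr fun n ↦ ?_
  · rw [norm_pow]; exact pow_lt_one₀ (norm_nonneg _) hr two_ne_zero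
  · ring

lemma euler_ne_zero {q : ℂ} (hq : ‖q‖ < 1) : euler q ≠ 0 := by
  simp_rw [euler, sub_eq_add_neg]
  refine tprod_one_add_ne_zero_of_summable (fun n ↦ ?_) (by simpa using summable_norm_pow_succ hq)
  simpa [sub_eq_add_neg] using one_sub_pow_ne_zero hq n

lemma tendsto_qFactorial {q : ℂ} (hq : ‖q‖ < 1) :
    Tendsto (qFactorial q) atTop (𝓝 (euler q)) :=
  (ModularForm.multipliable_one_sub_pow hq).hasProd.tendsto_prod_nat

lemma qFactorial_ne_zero {q : ℂ} (hq : ‖q‖ < 1) (n : ℕ) : qFactorial q n ≠ 0 :=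
  prod_ne_zero_iff.mpr fun j _ ↦ one_sub_pow_ne_zero hq j

/-- The $q$-factorials converge to a nonzero limit, so they and their inverses are bounded. The
uniform bound supplies the majorant in the limit that gives the triple product. -/
lemma exists_norm_gaussBinom_le {q : ℂ} (hq : ‖q‖ < 1) :
    ∃ C : ℝ, ∀ n k, ‖gaussBinom q n k‖ ≤ C := by
  obtain ⟨A, hA⟩ := (Metric.isBounded_range_of_tendsto _ (tendsto_qFactorial hq)).exists_norm_le
  obtain ⟨B, hB⟩ := (Metric.isBounded_range_of_tendsto _
    ((tendsto_qFactorial hq).inv₀ (euler_ne_zero hq))).exists_norm_le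
  simp only [Set.mem_range, forall_exists_index, forall_apply_eq_imp_iff] at hA hB
  have hA0 := (norm_nonneg _).trans (hA 0)
  have hB0 := (norm_nonneg _).trans (hB 0)
  refine ⟨A * (B * B), fun n k ↦ ?_⟩
  rcases lt_or_ge n k with h | h
  · rw [gaussBinom_eq_zero q h, norm_zero]; positivity
  · obtain ⟨b, rfl⟩ := Nat.exists_eq_add_of_le h
    have : gaussBinom q (k + b) k =
        qFactorial q (k + b) * ((qFactorial q k)⁻¹ * (qFactorial q b)⁻¹) := by
      rw [← gaussBinom_mul]
      field_simp [qFactorial_ne_zero hq]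
    rw [this, norm_mul, norm_mul]
    gcongr
    exacts [hA _, hB _, hB _]

/-- This is the $q$-binomial theorem with base $r^2$, length $2N$ and variable $yr^{1-2N}$.
Reversing the first $N$ factors and extracting $yr^{-(2j+1)}$ from each leaves the product in
$y^{-1}$; the extracted monomial $y^Nr^{-N^2}$ recentres the sum at $k=N$. -/
lemma prod_finite_triple {r y : ℂ} (hr : r ≠ 0) (hy : y ≠ 0) (N : ℕ) :
    (∏ j ∈ range N, (1 + y * r ^ (2 * j + 1))) * ∏ j ∈ range N, (1 + y⁻¹ * r ^ (2 * j + 1)) =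
      ∑ k ∈ range (2 * N + 1), gaussBinom (r ^ 2) (2 * N) k * r ^ (((k : ℤ) - N) ^ 2)
        * y ^ ((k : ℤ) - N) := by
  have key := prod_one_add_mul_pow (r ^ 2) (y * r ^ (1 - 2 * N : ℤ)) (2 * N)
  rw [two_mul, prod_range_add, ← two_mul, ← prod_range_reflect] at key
  have h1 : ∏ j ∈ range N, (1 + y * r ^ (1 - 2 * N : ℤ) * (r ^ 2) ^ (N + j)) =
      ∏ j ∈ range N, (1 + y * r ^ (2 * j + 1)) := by
    refine prod_congr rfl fun j _ ↦ ?_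
    rw [mul_assoc, ← pow_mul, ← zpow_natCast r (2 * (N + j)), ← zpow_add₀ hr, ← zpow_natCast]
    congr 3; push_cast; ring
  have h2 : ∏ j ∈ range N, (1 + y * r ^ (1 - 2 * N : ℤ) * (r ^ 2) ^ (N - 1 - j)) =
      ∏ j ∈ range N, ((y * r ^ (-(2 * j + 1) : ℤ)) * (1 + y⁻¹ * r ^ (2 * j + 1))) := by
    refine prod_congr rfl fun j hj ↦ ?_
    have hj := mem_range.mp hj
    rw [mul_assoc, ← pow_mul, ← zpow_natCast r (2 * (N - 1 - j)), ← zpow_add₀ hr,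
      show (1 - 2 * N + (2 * (N - 1 - j) : ℕ) : ℤ) = -(2 * j + 1) by omega, mul_add, mul_one,
      ← zpow_natCast r]
    have : y * r ^ (-(2 * j + 1) : ℤ) * (y⁻¹ * r ^ ((2 * j + 1 : ℕ) : ℤ)) = 1 := by
      rw [mul_mul_mul_comm, mul_inv_cancel₀ hy, ← zpow_add₀ hr]; simp
    rw [this, add_comm]
  have h3 : ∏ j ∈ range N, (y * r ^ (-(2 * j + 1) : ℤ)) = y ^ N * r ^ (-(N : ℤ) ^ 2) := by
    clear key h1 h2
    induction N with
    | zero => simp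
    | succ n ih =>
      rw [prod_range_succ, ih, pow_succ, mul_mul_mul_comm, ← zpow_add₀ hr]
      congr 2; push_cast; ring
  rw [h1, h2, prod_mul_distrib, h3] at key
  have h4 : y ^ N * r ^ (-(N : ℤ) ^ 2) ≠ 0 := mul_ne_zero (pow_ne_zero _ hy) (zpow_ne_zero _ hr)
  apply mul_left_cancel₀ h4
  rw [mul_sum]
  calc _ = _ := by ring
    _ = _ := key
    _ = _ := sum_congr rfl fun k _ ↦ ?_
  have e1 : ((k.choose 2 : ℕ) : ℤ) * 2 = k * (k - 1) := by
    have : k.choose 2 * 2 = k * (k - 1) := by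
      rw [Nat.choose_two_right, Nat.div_mul_cancel (Nat.even_mul_pred_self k).two_dvd]
    zify at this
    rcases k with _ | k
    · simp
    · simpa using this
  have e2 : (r ^ 2) ^ k.choose 2 * (r ^ (1 - 2 * N : ℤ)) ^ k =
      r ^ (-(N : ℤ) ^ 2) * r ^ (((k : ℤ) - N) ^ 2) := by
    rw [← pow_mul, ← zpow_natCast (r ^ (1 - 2 * N : ℤ)), ← zpow_mul, ← zpow_natCast r,
      ← zpow_add₀ hr, ← zpow_add₀ hr]
    congr 1; push_cast; linear_combination e1
  have e3 : y ^ N * (y ^ k / y ^ N) = y ^ k := mul_div_cancel₀ _ (pow_ne_zero _ hy)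
  rw [mul_pow, zpow_sub₀ hy, zpow_natCast, zpow_natCast]
  linear_combination gaussBinom (r ^ 2) (2 * N) k * y ^ k * e2 -
    gaussBinom (r ^ 2) (2 * N) k * r ^ (-(N : ℤ) ^ 2) * r ^ (((k : ℤ) - N) ^ 2) * e3

/-- This is a Jacobi theta series with parameter $\log r/(\pi i)$, whose imaginary part is
$-\log|r|/\pi>0$. -/
lemma summable_zpow_sq_mul_zpow {r y : ℂ} (hr0 : r ≠ 0) (hr : ‖r‖ < 1) (hy : y ≠ 0) :
    Summable fun n : ℤ ↦ r ^ (n ^ 2) * y ^ n := by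
  have him : 0 < (Complex.log r / (Real.pi * Complex.I)).im := by
    have : Complex.log r / (Real.pi * Complex.I) = -(Complex.log r / Real.pi) * Complex.I := by
      field_simp; rw [Complex.I_sq]; ring
    rw [this, Complex.mul_I_im, Complex.neg_re, Complex.div_ofReal_re, Complex.log_re]
    have := Real.log_neg (norm_pos_iff.mpr hr0) hr
    have := div_neg_of_neg_of_pos this Real.pi_pos
    linarith
  refine ((summable_jacobiTheta₂_term_iff (Complex.log y / (2 * Real.pi * Complex.I)) _).mpr
    him).congr fun n ↦ ?_
  have h1 := Real.pi_ne_zero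
  rw [jacobiTheta₂_term, Complex.exp_add, mul_comm]
  congr 1
  · nth_rw 2 [← Complex.exp_log hr0]
    rw [← Complex.exp_int_mul]
    congr 1; push_cast; field_simp
  · nth_rw 2 [← Complex.exp_log hy]
    rw [← Complex.exp_int_mul]
    congr 1; field_simp

/-- Jacobi's triple product identity. -/
theorem tsum_zpow_sq_mul_zpow {r y : ℂ} (hr0 : r ≠ 0) (hr : ‖r‖ < 1) (hy : y ≠ 0) :
    ∑' n : ℤ, r ^ (n ^ 2) * y ^ n = euler (r ^ 2) * ((∏' n : ℕ, (1 + y * r ^ (2 * n + 1))) *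
      ∏' n : ℕ, (1 + y⁻¹ * r ^ (2 * n + 1))) := by
  have hq : ‖r ^ 2‖ < 1 := by rw [norm_pow]; exact pow_lt_one₀ (norm_nonneg _) hr two_ne_zero
  set f : ℕ → ℤ → ℂ := fun N m ↦ if m ∈ Icc (-N : ℤ) N then
    gaussBinom (r ^ 2) (2 * N) (m + N).toNat * r ^ (m ^ 2) * y ^ m else 0 with hf
  have hlim := ((multipliable_one_add_mul_pow_odd hr y).hasProd.tendsto_prod_nat.mul
    (multipliable_one_add_mul_pow_odd hr y⁻¹).hasProd.tendsto_prod_nat)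
  have hsum (N : ℕ) : ∑' m : ℤ, f N m =
      (∏ j ∈ range N, (1 + y * r ^ (2 * j + 1))) *
        ∏ j ∈ range N, (1 + y⁻¹ * r ^ (2 * j + 1)) := by
    rw [prod_finite_triple hr0 hy, tsum_eq_sum (s := Icc (-N : ℤ) N)
      (fun m hm ↦ by simp only [hf]; rw [if_neg hm])]
    symm
    refine sum_bij' (fun k _ ↦ (k : ℤ) - N) (fun m _ ↦ (m + N).toNat) ?_ ?_ ?_ ?_ ?_
    · intro k hk; rw [mem_range] at hk; rw [mem_Icc]; omega
    · intro m hm; rw [mem_Icc] at hm; rw [mem_range]; omega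
    · intro k hk; simp
    · intro m hm; rw [mem_Icc] at hm; omega
    · intro k hk
      rw [mem_range] at hk
      have : (k : ℤ) - N ∈ Icc (-N : ℤ) N := by rw [mem_Icc]; omega
      simp only [hf]
      rw [if_pos this]
      simp
  obtain ⟨C, hC⟩ := exists_norm_gaussBinom_le hq
  have hlim2 : Tendsto (fun N ↦ ∑' m : ℤ, f N m) atTop
      (𝓝 (∑' m : ℤ, (euler (r ^ 2))⁻¹ * (r ^ (m ^ 2) * y ^ m))) := by
    refine tendsto_tsum_of_dominated_convergence
      (bound := fun m ↦ C * ‖r ^ (m ^ 2) * y ^ m‖)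
      ((summable_zpow_sq_mul_zpow hr0 hr hy).norm.mul_left C) (fun m ↦ ?_)
      (Eventually.of_forall fun N m ↦ ?_)
    · have h1 : Tendsto (fun N : ℕ ↦ 2 * N) atTop atTop :=
        tendsto_atTop_mono (fun N ↦ (by omega : N ≤ 2 * N)) tendsto_id
      have h2 : Tendsto (fun N : ℕ ↦ (m + N).toNat) atTop atTop :=
        tendsto_atTop_atTop.mpr fun b ↦ ⟨b + m.natAbs, fun N hN ↦ by omega⟩
      have h3 : Tendsto (fun N : ℕ ↦ (N - m).toNat) atTop atTop :=
        tendsto_atTop_atTop.mpr fun b ↦ ⟨b + m.natAbs, fun N hN ↦ by omega⟩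
      -- For fixed $m$ the coefficient is $(q)_{2N}/((q)_{N+m}(q)_{N-m})$ with $q=r^2$, and all
      -- three indices tend to infinity.
      have h4 := ((tendsto_qFactorial hq).comp h1).mul
        ((((tendsto_qFactorial hq).comp h2).mul ((tendsto_qFactorial hq).comp h3)).inv₀
          (mul_ne_zero (euler_ne_zero hq) (euler_ne_zero hq)))
      have h5 : euler (r ^ 2) * (euler (r ^ 2) * euler (r ^ 2))⁻¹ = (euler (r ^ 2))⁻¹ := by
        field_simp [euler_ne_zero hq]
      rw [h5] at h4
      refine (h4.mul_const (r ^ (m ^ 2) * y ^ m)).congr' ?_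
      filter_upwards [eventually_ge_atTop m.natAbs] with N hN
      have : m ∈ Icc (-N : ℤ) N := by rw [mem_Icc]; omega
      simp only [hf, Function.comp]
      rw [if_pos this, ← mul_assoc]
      congr 2
      have h6 := gaussBinom_mul (r ^ 2) (m + N).toNat (N - m).toNat
      rw [show (m + N).toNat + (N - m).toNat = 2 * N by omega] at h6
      rw [← h6]
      field_simp [qFactorial_ne_zero hq]
    · simp only [hf]
      split_ifs
      · rw [mul_assoc, norm_mul]
        gcongr
        exact hC _ _
      · rw [norm_zero]
        exact mul_nonneg ((norm_nonneg _).trans (hC 0 0)) (norm_nonneg _)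
  simp_rw [hsum] at hlim2
  have := tendsto_nhds_unique hlim hlim2
  rw [this, tsum_mul_left, ← mul_assoc, mul_inv_cancel₀ (euler_ne_zero hq), one_mul]

/-! ### Product formulas for the theta functions. -/

lemma tprod_eq_prod_tprod_add {f : ℕ → ℂ} {k : ℕ} (hk : 0 < k) (hf : Multipliable f)
    (hi : ∀ i ∈ range k, Multipliable fun n ↦ f (k * n + i)) :
    ∏' n, f n = ∏ i ∈ range k, ∏' n, f (k * n + i) := by
  have h1 := hf.hasProd.tendsto_prod_nat.comp
    (tendsto_id.const_mul_atTop' hk : Tendsto (fun N : ℕ ↦ k * N) atTop atTop)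
  have h2 := tendsto_finsetProd (range k) fun i h ↦ (hi i h).hasProd.tendsto_prod_nat
  refine tendsto_nhds_unique h1 (h2.congr fun N ↦ ?_)
  rw [Finset.prod_comm]
  simp only [Function.comp]
  induction N with
  | zero => simp
  | succ N ih => rw [prod_range_succ, ih, mul_add_one, prod_range_add]

lemma norm_pow_lt_one {q : ℂ} (hq : ‖q‖ < 1) {k : ℕ} (hk : k ≠ 0) : ‖q ^ k‖ < 1 := by
  rw [norm_pow]; exact pow_lt_one₀ (norm_nonneg _) hq hk

/-- The product `∏_{n ≥ 0} (1 + q^(2n+1))`. -/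
def oddProd (q : ℂ) : ℂ := ∏' n : ℕ, (1 + q ^ (2 * n + 1))

lemma multipliable_odd {q : ℂ} (hq : ‖q‖ < 1) : Multipliable fun n : ℕ ↦ 1 + q ^ (2 * n + 1) := by
  simpa using multipliable_one_add_mul_pow_odd hq 1

lemma multipliable_one_add_pow_mul_add {q : ℂ} (hq : ‖q‖ < 1) {k : ℕ} (hk : k ≠ 0) (i : ℕ) (c : ℂ) :
    Multipliable fun n : ℕ ↦ 1 + c * q ^ (k * n + i) := by
  refine (multipliable_one_add_mul_pow (norm_pow_lt_one hq hk) (c * q ^ i)).congr fun n ↦ ?_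
  ring

lemma euler_eq {q : ℂ} (hq : ‖q‖ < 1) : euler q = oddProd (-q) * euler (q ^ 2) := by
  rw [euler, tprod_eq_prod_tprod_add (k := 2) two_pos (ModularForm.multipliable_one_sub_pow hq)]
  · simp only [prod_range_succ, range_zero, prod_empty, one_mul, oddProd, euler]
    congr 1
    · refine tprod_congr fun n ↦ ?_
      rw [Odd.neg_pow ⟨n, rfl⟩, sub_eq_add_neg, add_zero]
    · refine tprod_congr fun n ↦ ?_
      ring
  · intro i _
    refine (multipliable_one_add_pow_mul_add hq two_ne_zero (i + 1) (-1)).congr fun n ↦ ?_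
    ring

lemma oddProd_ne_zero {q : ℂ} (hq : ‖q‖ < 1) : oddProd q ≠ 0 := by
  have := euler_eq (q := -q) (by simpa using hq)
  rw [neg_neg] at this
  exact left_ne_zero_of_mul (this ▸ euler_ne_zero (by simpa using hq))

lemma oddProd_mul_neg {q : ℂ} (hq : ‖q‖ < 1) : oddProd q * oddProd (-q) = oddProd (-q ^ 2) := by
  have hq' : ‖-q‖ < 1 := by simpa using hq
  rw [oddProd, oddProd, oddProd, ← (multipliable_odd hq).tprod_mul (multipliable_odd hq')]
  refine tprod_congr fun n ↦ ?_
  rw [Odd.neg_pow ⟨n, rfl⟩, Odd.neg_pow ⟨n, rfl⟩]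
  ring

lemma euler_mul_oddProd {q : ℂ} (hq : ‖q‖ < 1) :
    oddProd q * (euler q * euler (q ^ 4)) = euler (q ^ 2) ^ 2 := by
  have h1 := euler_eq hq
  have h2 := euler_eq (norm_pow_lt_one hq two_ne_zero)
  rw [← oddProd_mul_neg hq, ← pow_mul] at h2
  rw [h1]
  linear_combination -euler (q ^ 2) * h2

lemma euler_neg {q : ℂ} (hq : ‖q‖ < 1) :
    euler (-q) * (euler q * euler (q ^ 4)) = euler (q ^ 2) ^ 3 := by
  have := euler_eq (q := -q) (by simpa using hq)
  rw [neg_neg, neg_sq] at this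
  rw [this]
  linear_combination euler (q ^ 2) * euler_mul_oddProd hq

lemma oddProd_eq {q : ℂ} (hq : ‖q‖ < 1) :
    oddProd q = euler (q ^ 2) ^ 2 / (euler q * euler (q ^ 4)) :=
  eq_div_of_mul_eq (mul_ne_zero (euler_ne_zero hq) (euler_ne_zero (norm_pow_lt_one hq four_ne_zero)))
    (euler_mul_oddProd hq)

/-- Ramanujan's theta function `φ(q) = ∑ q^(n²)`. -/
def phi (q : ℂ) : ℂ := ∑' n : ℤ, q ^ (n ^ 2)

/-- The series `∑ q^(n² + n)` over the integers, twice Ramanujan's `ψ(q²)`. -/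
def psi (q : ℂ) : ℂ := ∑' n : ℤ, q ^ (n ^ 2 + n)

lemma phi_eq {q : ℂ} (hq0 : q ≠ 0) (hq : ‖q‖ < 1) :
    phi q = euler (q ^ 2) ^ 5 / (euler q ^ 2 * euler (q ^ 4) ^ 2) := by
  have := tsum_zpow_sq_mul_zpow hq0 hq one_ne_zero
  simp only [one_zpow, mul_one, inv_one, one_mul] at this
  rw [phi, this, ← oddProd, oddProd_eq hq]
  ring

lemma psi_eq {q : ℂ} (hq0 : q ≠ 0) (hq : ‖q‖ < 1) :
    psi q = 2 * euler (q ^ 4) ^ 2 / euler (q ^ 2) := by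
  have hq2 := norm_pow_lt_one hq two_ne_zero
  have hq4 := norm_pow_lt_one hq four_ne_zero
  have h := tsum_zpow_sq_mul_zpow hq0 hq hq0
  simp_rw [← zpow_add₀ hq0] at h
  have h1 : ∏' n : ℕ, (1 + q * q ^ (2 * n + 1)) = euler (q ^ 4) / euler (q ^ 2) := by
    rw [eq_div_iff (euler_ne_zero hq2), euler, euler, ← Multipliable.tprod_mul]
    · refine tprod_congr fun n ↦ ?_
      ring
    · exact multipliable_one_add_mul_pow_odd hq q
    · exact ModularForm.multipliable_one_sub_pow hq2
  have h2 : ∏' n : ℕ, (1 + q⁻¹ * q ^ (2 * n + 1)) = 2 * (euler (q ^ 4) / euler (q ^ 2)) := by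
    -- The factor at $n=0$ is $1+q^{-1}q=2$; the remaining ones are those of the first product.
    rw [← h1, tprod_eq_zero_mul']
    · simp only [mul_zero, zero_add, pow_one, inv_mul_cancel₀ hq0]
      congr 1
      · norm_num
      · refine tprod_congr fun n ↦ ?_
        rw [mul_add_one, pow_succ _ (2 * n + 2), mul_comm (q ^ _) q, inv_mul_cancel_left₀ hq0]
        ring
    · refine (multipliable_one_add_mul_pow_odd hq q).congr fun n ↦ ?_
      rw [mul_add_one, pow_succ _ (2 * n + 2), mul_comm (q ^ _) q, inv_mul_cancel_left₀ hq0]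
      ring
  rw [psi, h, h1, h2]
  field_simp [euler_ne_zero hq2]

/-! ### The quintic relation between $\varphi(q)^2$ and $\varphi(q^5)^2$. -/

/-- The bijection behind the decomposition of the Gaussian integers into residue classes
modulo `2 + i`. -/
def gaussResidue (p : Fin 5 × ℤ × ℤ) : ℤ × ℤ :=
  (2 * p.2.1 - p.2.2 + ![0, 1, 0, -1, 0] p.1, p.2.1 + 2 * p.2.2 + ![0, 0, 1, 0, -1] p.1)

lemma gaussResidue_bijective : Function.Bijective gaussResidue := by
  constructor
  · rintro ⟨c, x, y⟩ ⟨d, z, w⟩ h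
    simp only [gaussResidue, Prod.mk.injEq] at h
    obtain ⟨h1, h2⟩ := h
    fin_cases c <;> fin_cases d <;> simp at h1 h2 ⊢ <;> omega
  · rintro ⟨m, n⟩
    have : (m - 2 * n) % 5 = 0 ∨ (m - 2 * n) % 5 = 1 ∨ (m - 2 * n) % 5 = 2 ∨
      (m - 2 * n) % 5 = 3 ∨ (m - 2 * n) % 5 = 4 := by omega
    rcases this with h | h | h | h | h
    · exact ⟨(0, (2 * m + n) / 5, (2 * n - m) / 5), by
        simp only [gaussResidue, Prod.mk.injEq]; simp; omega⟩
    · exact ⟨(1, (2 * m + n - 2) / 5, (2 * n - m + 1) / 5), by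
        simp only [gaussResidue, Prod.mk.injEq]; simp; omega⟩
    · exact ⟨(4, (2 * m + n + 1) / 5, (2 * n - m + 2) / 5), by
        simp only [gaussResidue, Prod.mk.injEq]; simp; omega⟩
    · exact ⟨(2, (2 * m + n - 1) / 5, (2 * n - m - 2) / 5), by
        simp only [gaussResidue, Prod.mk.injEq]; simp; omega⟩
    · exact ⟨(3, (2 * m + n + 2) / 5, (2 * n - m - 1) / 5), by
        simp only [gaussResidue, Prod.mk.injEq]; simp; omega⟩

lemma tsum_eq_sum_tsum_of_bijective {ι α β : Type*} [Fintype ι] {g : ι × α → β}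
    (hg : Function.Bijective g) {f : β → ℂ} (hf : Summable f) :
    ∑' b, f b = ∑ i, ∑' a, f (g (i, a)) := by
  obtain ⟨e, he⟩ : ∃ e : ι × α ≃ β, ∀ p, e p = g p :=
    ⟨Equiv.ofBijective g hg, fun p ↦ Equiv.ofBijective_apply _ _ p⟩
  have h := (e.summable_iff.mpr hf).tsum_prod
  simp only [Function.comp_def] at h
  rw [e.tsum_eq f] at h
  rw [h, tsum_fintype]
  simp only [he]

lemma summable_zpow_sq {q : ℂ} (hq0 : q ≠ 0) (hq : ‖q‖ < 1) : Summable fun n : ℤ ↦ q ^ (n ^ 2) := by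
  simpa using summable_zpow_sq_mul_zpow hq0 hq one_ne_zero

lemma summable_mul_int {f g : ℤ → ℂ} (hf : Summable f) (hg : Summable g) :
    Summable fun p : ℤ × ℤ ↦ f p.1 * g p.2 :=
  summable_mul_of_summable_norm hf.norm hg.norm

lemma tsum_mul_tsum_int {f g : ℤ → ℂ} (hf : Summable f) (hg : Summable g) :
    (∑' m, f m) * ∑' n, g n = ∑' p : ℤ × ℤ, f p.1 * g p.2 :=
  tsum_mul_tsum_of_summable_norm hf.norm hg.norm

/-- The theta function `∑ q^(5n² + 2kn)`. -/
def theta5 (k : ℤ) (q : ℂ) : ℂ := ∑' n : ℤ, q ^ (5 * n ^ 2 + 2 * k * n)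

lemma theta5_neg (k : ℤ) (q : ℂ) : theta5 (-k) q = theta5 k q := by
  rw [theta5, ← (Equiv.neg ℤ).tsum_eq]
  refine tsum_congr fun n ↦ ?_
  simp

/-- The exponent is the norm of $(2+i)(x+iy)+(a+bi)$. Multiplication by $2+i$ is a similarity, so
there is no $xy$ term and the double sum factors. The hypothesis holds with $k=2a+b$, $l=2b-a$,
$d=a^2+b^2$. -/
lemma tsum_gaussResidue {q : ℂ} (hq0 : q ≠ 0) (hq : ‖q‖ < 1) (a b k l d : ℤ)
    (h : ∀ x y : ℤ, (2 * x - y + a) ^ 2 + (x + 2 * y + b) ^ 2 =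
      d + (5 * x ^ 2 + 2 * k * x) + (5 * y ^ 2 + 2 * l * y)) :
    ∑' p : ℤ × ℤ, q ^ ((2 * p.1 - p.2 + a) ^ 2) * q ^ ((p.1 + 2 * p.2 + b) ^ 2) =
      q ^ d * (theta5 k q * theta5 l q) := by
  have hs5 (k : ℤ) : Summable fun n : ℤ ↦ q ^ (5 * n ^ 2 + 2 * k * n) := by
    refine (summable_zpow_sq_mul_zpow (pow_ne_zero 5 hq0) (norm_pow_lt_one hq (by norm_num))
      (zpow_ne_zero (2 * k) hq0)).congr fun n ↦ ?_
    rw [zpow_add₀ hq0, zpow_mul q (2 * k), zpow_mul q 5, zpow_ofNat]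
  rw [theta5, theta5, tsum_mul_tsum_int (hs5 k) (hs5 l), ← tsum_mul_left]
  refine tsum_congr fun p ↦ ?_
  rw [← zpow_add₀ hq0, ← zpow_add₀ hq0, ← zpow_add₀ hq0, h, add_assoc]

/-- $\varphi(q)^2$ sums $q$ to the norm over the Gaussian integers. The class of $0$ modulo $2+i$
gives $\varphi(q^5)^2$; the other four are represented by the units and contribute equally. -/
lemma phi_sq_sub_phi_sq {q : ℂ} (hq0 : q ≠ 0) (hq : ‖q‖ < 1) :
    phi q ^ 2 - phi (q ^ 5) ^ 2 = 4 * q * (theta5 2 q * theta5 1 q) := by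
  have hs := summable_zpow_sq hq0 hq
  have hsum := summable_mul_int hs hs
  have h0 : phi (q ^ 5) = theta5 0 q := by
    refine tsum_congr fun n ↦ ?_
    rw [mul_zero, zero_mul, add_zero, zpow_mul, zpow_ofNat]
  have key := tsum_eq_sum_tsum_of_bijective gaussResidue_bijective hsum
  rw [← tsum_mul_tsum_int hs hs, ← phi, ← sq] at key
  simp only [gaussResidue] at key
  rw [key, Fin.sum_univ_five]
  have h1 := tsum_gaussResidue hq0 hq 0 0 0 0 0 (by intro x y; ring)
  have h2 := tsum_gaussResidue hq0 hq 1 0 2 (-1) 1 (by intro x y; ring)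
  have h3 := tsum_gaussResidue hq0 hq 0 1 1 2 1 (by intro x y; ring)
  have h4 := tsum_gaussResidue hq0 hq (-1) 0 (-2) 1 1 (by intro x y; ring)
  have h5 := tsum_gaussResidue hq0 hq 0 (-1) (-1) (-2) 1 (by intro x y; ring)
  simp only [Matrix.cons_val]
  rw [h1, h2, h3, h4, h5, h0]
  simp only [theta5_neg, zpow_zero, zpow_one]
  ring

/-- By the triple product the two theta functions carry the exponents $1,3,7,9$ modulo $10$; the
factor `oddProd (q ^ 5)` supplies the missing class $5$. -/
lemma theta5_mul_theta5 {q : ℂ} (hq0 : q ≠ 0) (hq : ‖q‖ < 1) :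
    theta5 2 q * theta5 1 q * oddProd (q ^ 5) = euler (q ^ 10) ^ 2 * oddProd q := by
  have h (k a b : ℕ) (ha : a = 5 + 2 * k) (hb : b + 2 * k = 5) : theta5 k q = euler (q ^ 10) *
      ((∏' n : ℕ, (1 + q ^ (10 * n + a))) * ∏' n : ℕ, (1 + q ^ (10 * n + b))) := by
    have := tsum_zpow_sq_mul_zpow (pow_ne_zero 5 hq0) (norm_pow_lt_one hq (by norm_num))
      (pow_ne_zero (2 * k) hq0)
    rw [← pow_mul] at this
    refine Eq.trans (tsum_congr fun n ↦ ?_) (this.trans ?_)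
    · rw [zpow_add₀ hq0, zpow_mul q (2 * k), zpow_mul q 5, zpow_ofNat, ← zpow_natCast q (2 * k)]
      push_cast; rfl
    · congr 2
      · refine tprod_congr fun n ↦ ?_
        rw [ha]; ring
      · refine tprod_congr fun n ↦ ?_
        rw [← pow_mul, show 5 * (2 * n + 1) = 2 * k + (10 * n + b) by omega, pow_add,
          inv_mul_cancel_left₀ (pow_ne_zero _ hq0)]
  have h1 := h 1 7 3 rfl rfl
  have h2 := h 2 9 1 rfl rfl
  have ho : oddProd q = ∏ i ∈ range 5, ∏' n : ℕ, (1 + q ^ (10 * n + (2 * i + 1))) := by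
    rw [oddProd, tprod_eq_prod_tprod_add (k := 5) (by norm_num) (multipliable_odd hq)]
    · refine prod_congr rfl fun i _ ↦ tprod_congr fun n ↦ ?_
      ring
    · intro i _
      refine (multipliable_one_add_pow_mul_add hq (k := 10) (by norm_num) (2 * i + 1) 1).congr
        fun n ↦ ?_
      ring
  have ho5 : oddProd (q ^ 5) = ∏' n : ℕ, (1 + q ^ (10 * n + 5)) := tprod_congr fun n ↦ by ring
  push_cast at h1 h2
  rw [h1, h2, ho, ho5]
  simp only [prod_range_succ, range_zero, prod_empty]
  norm_num
  ring

/-- The relation between `φ(q)` and `φ(q⁵)` in terms of Euler products. -/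
lemma euler_identity {q : ℂ} (hq0 : q ≠ 0) (hq : ‖q‖ < 1) :
    (euler (q ^ 2) ^ 5 / (euler q ^ 2 * euler (q ^ 4) ^ 2)) ^ 2 -
      (euler (q ^ 10) ^ 5 / (euler (q ^ 5) ^ 2 * euler (q ^ 20) ^ 2)) ^ 2 =
    4 * q * (euler (q ^ 2) ^ 2 * euler (q ^ 5) * euler (q ^ 20) / (euler q * euler (q ^ 4))) := by
  have hq5 := norm_pow_lt_one hq (k := 5) (by norm_num)
  have h := phi_sq_sub_phi_sq hq0 hq
  rw [phi_eq hq0 hq, phi_eq (pow_ne_zero 5 hq0) hq5] at h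
  simp only [← pow_mul, Nat.reduceMul] at h
  rw [h]
  congr 1
  apply mul_right_cancel₀ (oddProd_ne_zero hq5)
  rw [theta5_mul_theta5 hq0 hq, oddProd_eq hq, oddProd_eq hq5]
  simp only [← pow_mul, Nat.reduceMul]
  field_simp [euler_ne_zero hq5, euler_ne_zero (norm_pow_lt_one hq (by norm_num : 20 ≠ 0))]

/-! ### Derivatives of theta series and powers of Euler's product. -/

lemma nome_ne_zero (τ : ℂ) : nome τ ≠ 0 := Complex.exp_ne_zero _

lemma norm_nome_lt_one {τ : ℂ} (hτ : 0 < τ.im) : ‖nome τ‖ < 1 :=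
  UpperHalfPlane.norm_exp_two_pi_I_lt_one ⟨τ, hτ⟩

lemma nome_zpow (τ : ℂ) (n : ℤ) : nome τ ^ n = Complex.exp (2 * Real.pi * Complex.I * (n * τ)) := by
  rw [nome, ← Complex.exp_int_mul]; ring_nf

lemma summable_pow_mul_jacobiTheta₂_term (k : ℕ) (z : ℂ) {τ : ℂ} (hτ : 0 < τ.im) :
    Summable fun n : ℤ ↦ (n : ℂ) ^ k * jacobiTheta₂_term n z τ := by
  refine (summable_pow_mul_jacobiTheta₂_term_bound |z.im| hτ k).of_norm_bounded fun n ↦ ?_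
  rw [norm_mul, norm_pow, Complex.norm_intCast]
  push_cast
  gcongr
  simpa using norm_jacobiTheta₂_term_le hτ le_rfl le_rfl n

lemma jacobiTheta₂_term_nome (c n : ℤ) (τ : ℂ) :
    jacobiTheta₂_term n (c * τ) (2 * τ) = nome τ ^ (n ^ 2 + c * n) := by
  rw [jacobiTheta₂_term, nome_zpow]
  congr 1; push_cast; ring

lemma summable_pow_mul_nome (k : ℕ) (c : ℤ) {τ : ℂ} (hτ : 0 < τ.im) :
    Summable fun n : ℤ ↦ (n : ℂ) ^ k * nome τ ^ (n ^ 2 + c * n) := by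
  simpa only [jacobiTheta₂_term_nome] using
    summable_pow_mul_jacobiTheta₂_term k (c * τ) (τ := 2 * τ) (by simpa using hτ)

lemma hasDerivAt_tsum_nome (c : ℤ) {τ : ℂ} (hτ : 0 < τ.im) :
    HasDerivAt (fun τ ↦ ∑' n : ℤ, nome τ ^ (n ^ 2 + c * n))
      (2 * Real.pi * Complex.I *
        ∑' n : ℤ, ((n : ℂ) ^ 2 + c * n) * nome τ ^ (n ^ 2 + c * n)) τ := by
  have h2 : 0 < (2 * τ).im := by simpa using hτ
  have h1 := hasFDerivAt_jacobiTheta₂ (c * τ) h2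
  have h3 : HasDerivAt (fun τ : ℂ ↦ ((c : ℂ) * τ, 2 * τ)) ((c : ℂ), (2 : ℂ)) τ := by
    simpa using ((hasDerivAt_id τ).const_mul (c : ℂ)).prodMk ((hasDerivAt_id τ).const_mul 2)
  have h4 := HasFDerivAt.comp_hasDerivAt τ h1 h3
  have h5 := (ContinuousLinearMap.apply ℂ ℂ ((c : ℂ), (2 : ℂ))).hasSum
    (hasSum_jacobiTheta₂_term_fderiv (c * τ) h2)
  simp only [ContinuousLinearMap.apply_apply] at h5
  rw [← h5.tsum_eq] at h4
  have h6 : (fun τ ↦ ∑' n : ℤ, nome τ ^ (n ^ 2 + c * n)) =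
      (fun p : ℂ × ℂ ↦ jacobiTheta₂ p.1 p.2) ∘ fun τ : ℂ ↦ ((c : ℂ) * τ, 2 * τ) := by
    funext x
    simp only [Function.comp, jacobiTheta₂, jacobiTheta₂_term_nome]
  have h7 (n : ℤ) : 2 * Real.pi * Complex.I * (((n : ℂ) ^ 2 + c * n) * nome τ ^ (n ^ 2 + c * n)) =
      jacobiTheta₂_term_fderiv n (c * τ) (2 * τ) ((c : ℂ), (2 : ℂ)) := by
    rw [← jacobiTheta₂_term_nome, jacobiTheta₂_term_fderiv, ← jacobiTheta₂_term]
    simp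
    ring
  rw [h6, ← tsum_mul_left, tsum_congr h7]
  exact h4

lemma tendsto_tprod_one_sub_mul_pow {q : ℂ} (hq : ‖q‖ < 1) :
    Tendsto (fun x : ℂ ↦ ∏' n : ℕ, (1 - x * q ^ (n + 1))) (𝓝 1) (𝓝 (euler q)) := by
  have h := tendsto_tprod_one_add_of_dominated_convergence (𝓕 := 𝓝 (1 : ℂ))
    (f := fun (x : ℂ) (n : ℕ) ↦ -(x * q ^ (n + 1))) (g := fun n ↦ -q ^ (n + 1))
    (bound := fun n : ℕ ↦ 2 * ‖q ^ (n + 1)‖)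
  simp only [← sub_eq_add_neg] at h
  refine h ((summable_norm_pow_succ hq).mul_left 2) (fun k ↦ ?_) ?_
  · have : Continuous fun x : ℂ ↦ -(x * q ^ (k + 1)) := by fun_prop
    simpa using this.tendsto 1
  · filter_upwards [Metric.ball_mem_nhds (1 : ℂ) one_pos] with x hx k
    rw [norm_neg, norm_mul]
    gcongr
    have := norm_le_norm_add_norm_sub' x 1
    rw [Metric.mem_ball, dist_eq_norm] at hx
    simp at this
    linarith

/-- Jacobi's identity for the cube of Euler's product, as a sum over all integers. -/
lemma tsum_mul_neg_one_zpow {r : ℂ} {τ : ℂ} (hτ : 0 < τ.im)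
    (hr : r = Complex.exp (Real.pi * Complex.I * τ)) :
    ∑' n : ℤ, (n : ℂ) * ((-1) ^ n * r ^ (n ^ 2 - n)) = -euler (r ^ 2) ^ 3 := by
  have hr0 : r ≠ 0 := hr ▸ Complex.exp_ne_zero _
  have hr2 : r ^ 2 = nome τ := by
    rw [hr, nome, ← Complex.exp_nat_mul]; congr 1; push_cast; ring
  have hq : ‖r ^ 2‖ < 1 := hr2 ▸ norm_nome_lt_one hτ
  have hr1 : ‖r‖ < 1 := by
    rw [norm_pow] at hq
    exact lt_of_pow_lt_pow_left₀ 2 zero_le_one (by simpa using hq)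
  set x : ℂ → ℂ := fun z ↦ Complex.exp (2 * Real.pi * Complex.I * z) with hx
  have hx0 (z : ℂ) : x z ≠ 0 := Complex.exp_ne_zero _
  -- The shift by $1/2-\tau/2$ moves a zero of the theta function to $z=0$. Jacobi's identity
  -- compares the derivative there computed from the series and from the product.
  have hterm (n : ℤ) (z : ℂ) : jacobiTheta₂_term n (z + (1 / 2 - τ / 2)) τ =
      r ^ (n ^ 2) * (-(x z) * r⁻¹) ^ n := by
    rw [mul_zpow, inv_zpow', ← neg_one_mul, mul_zpow, mul_comm, mul_assoc, ← zpow_add₀ hr0, hr, hx,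
      ← Complex.exp_int_mul, ← Complex.exp_int_mul, ← Complex.exp_pi_mul_I, ← Complex.exp_int_mul,
      jacobiTheta₂_term, ← Complex.exp_add, ← Complex.exp_add]
    congr 1; push_cast; ring
  set G : ℂ → ℂ := fun x ↦ euler (r ^ 2) * ((∏' n : ℕ, (1 - x * (r ^ 2) ^ (n + 1))) *
    ∏' n : ℕ, (1 - x⁻¹ * (r ^ 2) ^ (n + 1))) with hG
  have hprod (z : ℂ) : jacobiTheta₂ (z + (1 / 2 - τ / 2)) τ = (1 - x z) * G (x z) := by
    rw [jacobiTheta₂]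
    simp_rw [hterm]
    rw [tsum_zpow_sq_mul_zpow hr0 hr1 (by simp [hx0, hr0]), tprod_eq_zero_mul']
    · have h1 (n : ℕ) : 1 + -x z * r⁻¹ * r ^ (2 * (n + 1) + 1) = 1 - x z * (r ^ 2) ^ (n + 1) := by
        rw [pow_succ r (2 * (n + 1)), pow_mul]
        field_simp
        ring
      have h2 (n : ℕ) : 1 + (-x z * r⁻¹)⁻¹ * r ^ (2 * n + 1) = 1 - (x z)⁻¹ * (r ^ 2) ^ (n + 1) := by
        have := hx0 z
        field_simp
        ring
      simp_rw [h1, h2, hG]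
      have h3 : -x z * r⁻¹ * r ^ (2 * 0 + 1) = - x z := by
        rw [mul_zero, zero_add, pow_one]; field_simp
      rw [h3]; ring
    · refine (multipliable_one_add_mul_pow_odd hr1 (-x z * r)).congr fun n ↦ ?_
      field_simp
      ring
  have hder := (hasDerivAt_jacobiTheta₂_fst (0 + (1 / 2 - τ / 2)) hτ).comp_add_const 0 (1 / 2 - τ / 2)
  have hGlim : Tendsto (fun z ↦ G (x z)) (𝓝 0) (𝓝 (euler (r ^ 2) ^ 3)) := by
    have hxc : Tendsto x (𝓝 0) (𝓝 1) := by
      have : Continuous x := by fun_prop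
      simpa [hx] using this.tendsto 0
    have hxi : Tendsto (fun z ↦ (x z)⁻¹) (𝓝 0) (𝓝 1) := by simpa using hxc.inv₀ one_ne_zero
    have := (((tendsto_tprod_one_sub_mul_pow hq).comp hxc).mul
      ((tendsto_tprod_one_sub_mul_pow hq).comp hxi)).const_mul (euler (r ^ 2))
    rwa [← mul_assoc, ← pow_three'] at this
  have hxd : HasDerivAt x (2 * Real.pi * Complex.I) 0 := by
    simpa [hx] using ((hasDerivAt_id (0 : ℂ)).const_mul (2 * Real.pi * Complex.I)).cexp
  -- Since $1-x(z)$ vanishes at $0$, the slope needs only the limit of $G$, not its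
  -- differentiability.
  have hder2 : HasDerivAt (fun z ↦ (1 - x z) * G (x z))
      (-(2 * Real.pi * Complex.I) * euler (r ^ 2) ^ 3) 0 := by
    rw [hasDerivAt_iff_tendsto_slope] at hxd ⊢
    refine ((hxd.neg).mul (hGlim.mono_left nhdsWithin_le_nhds)).congr fun z ↦ ?_
    simp only [slope_def_field, hx]
    simp
    ring
  simp_rw [hprod] at hder
  have huniq := hder.unique hder2
  rw [jacobiTheta₂'] at huniq
  simp_rw [jacobiTheta₂'_term, hterm, mul_assoc (2 * (Real.pi : ℂ) * Complex.I)] at huniq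
  rw [tsum_mul_left] at huniq
  have huniq := mul_left_cancel₀ Complex.two_pi_I_ne_zero (huniq.trans (neg_mul_comm _ _))
  rw [← huniq]
  refine tsum_congr fun n ↦ ?_
  have : x 0 = 1 := by simp [hx]
  rw [this, ← neg_one_mul, mul_zpow, mul_zpow, one_zpow, mul_one, inv_zpow', zpow_sub₀ hr0,
    zpow_neg]
  ring_nf

/-- The indices $n=-2m$ and $n=2m+1$ share the exponent $n^2-n=2(2m^2+m)$, and their signed
coefficients add to $-(4m+1)$. -/
lemma euler_cube {τ : ℂ} (hτ : 0 < τ.im) :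
    ∑' m : ℤ, (4 * m + 1 : ℂ) * nome τ ^ (2 * m ^ 2 + m) = euler (nome τ) ^ 3 := by
  have hr0 := Complex.exp_ne_zero (Real.pi * Complex.I * τ)
  have h := tsum_mul_neg_one_zpow hτ rfl
  have hr2 : Complex.exp (Real.pi * Complex.I * τ) ^ 2 = nome τ := by
    rw [nome, ← Complex.exp_nat_mul]; congr 1; push_cast; ring
  set r := Complex.exp (Real.pi * Complex.I * τ) with hr
  have hterm (n : ℤ) : (n : ℂ) ^ 1 * jacobiTheta₂_term n (1 / 2 - τ / 2) τ =
      (n : ℂ) * ((-1) ^ n * r ^ (n ^ 2 - n)) := by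
    rw [jacobiTheta₂_term, hr, ← Complex.exp_pi_mul_I, ← Complex.exp_int_mul,
      ← Complex.exp_int_mul, ← Complex.exp_add, pow_one]
    congr 2; push_cast; ring
  have hs := (summable_pow_mul_jacobiTheta₂_term 1 (1 / 2 - τ / 2) hτ).congr hterm
  have hbij : Function.Bijective fun p : Fin 2 × ℤ ↦ ![-2 * p.2, 2 * p.2 + 1] p.1 := by
    constructor
    · rintro ⟨c, x⟩ ⟨d, y⟩ h
      fin_cases c <;> fin_cases d <;> simp at h ⊢ <;> omega
    · intro n
      rcases Int.even_or_odd' n with ⟨m, rfl | rfl⟩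
      · exact ⟨(0, -m), by simp⟩
      · exact ⟨(1, m), by simp⟩
  have h1 := tsum_eq_sum_tsum_of_bijective hbij hs
  have hs' (i : Fin 2) := (hs.comp_injective hbij.injective).comp_injective
    (i := fun m : ℤ ↦ (i, m)) (fun a b hab ↦ (Prod.mk.inj hab).2)
  simp only [Function.comp_def] at hs'
  rw [h, Fin.sum_univ_two, ← Summable.tsum_add (hs' 0) (hs' 1)] at h1
  rw [hr2] at h1
  rw [← neg_inj, h1, ← tsum_neg]
  refine tsum_congr fun m ↦ ?_
  simp only [Matrix.cons_val]
  have e1 : r ^ ((-2 * m) ^ 2 - -2 * m) = nome τ ^ (2 * m ^ 2 + m) := by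
    rw [← hr2, ← zpow_ofNat, ← zpow_mul]; congr 1; ring
  have e2 : r ^ ((2 * m + 1) ^ 2 - (2 * m + 1)) = nome τ ^ (2 * m ^ 2 + m) := by
    rw [← hr2, ← zpow_ofNat, ← zpow_mul]; congr 1; ring
  have e3 : (-1 : ℂ) ^ (-2 * m) = 1 := Even.neg_one_zpow ⟨-m, by ring⟩
  have e4 : (-1 : ℂ) ^ (2 * m + 1) = -1 := Odd.neg_one_zpow ⟨m, rfl⟩
  rw [e1, e2, e3, e4]
  push_cast
  ring

/-- The pairs $(x+y,x-y)$ are those with entries of equal parity. The reflection $s\mapsto-1-s$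
exchanges them with the pairs of opposite parity, so both halves contribute equally. -/
lemma tsum_int_prod_quadratic {f : ℤ × ℤ → ℂ} (hf : Summable f)
    (h : ∀ s t, f (-1 - s, t) = f (s, t)) :
    ∑' p, f p = 2 * ∑' p : ℤ × ℤ, f (p.1 + p.2, p.1 - p.2) := by
  have hbij : Function.Bijective fun p : Fin 2 × ℤ × ℤ ↦
      ((![p.2.1 + p.2.2, -1 - (p.2.1 + p.2.2)] p.1, p.2.1 - p.2.2) : ℤ × ℤ) := by
    constructor
    · rintro ⟨c, x, y⟩ ⟨d, z, w⟩ h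
      simp only [Prod.mk.injEq] at h
      obtain ⟨h1, h2⟩ := h
      fin_cases c <;> fin_cases d <;> simp at h1 h2 ⊢ <;> omega
    · rintro ⟨s, t⟩
      rcases Int.even_or_odd' (s + t) with ⟨m, h | h⟩
      · exact ⟨(0, m, s - m), by simp; omega⟩
      · exact ⟨(1, t - m - 1, -m - 1 ), by simp; omega⟩
  rw [tsum_eq_sum_tsum_of_bijective hbij hf, Fin.sum_univ_two, two_mul]
  simp only [Matrix.cons_val, h]

/-- The sixth power of Euler's product as a Wronskian of theta series. -/
lemma euler_pow_six {τ : ℂ} (hτ : 0 < τ.im) :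
    2 * euler (nome τ) ^ 6 =
      (4 * ∑' n : ℤ, ((n : ℂ) ^ 2 + n) * nome τ ^ (n ^ 2 + n)) * phi (nome τ)
      + psi (nome τ) * phi (nome τ)
      - 4 * psi (nome τ) * ∑' n : ℤ, (n : ℂ) ^ 2 * nome τ ^ (n ^ 2) := by
  have hq0 := nome_ne_zero τ
  have s00 : Summable fun n : ℤ ↦ nome τ ^ (n ^ 2) := by
    simpa using summable_pow_mul_nome 0 0 hτ
  have s20 : Summable fun n : ℤ ↦ (n : ℂ) ^ 2 * nome τ ^ (n ^ 2) := by
    simpa using summable_pow_mul_nome 2 0 hτ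
  have s01 : Summable fun n : ℤ ↦ nome τ ^ (n ^ 2 + n) := by
    simpa using summable_pow_mul_nome 0 1 hτ
  have s21 : Summable fun n : ℤ ↦ ((n : ℂ) ^ 2 + n) * nome τ ^ (n ^ 2 + n) := by
    simpa [add_mul] using (summable_pow_mul_nome 2 1 hτ).add (summable_pow_mul_nome 1 1 hτ)
  have hc : Summable fun m : ℤ ↦ (4 * m + 1 : ℂ) * nome τ ^ (2 * m ^ 2 + m) := by
    have h := (summable_pow_mul_jacobiTheta₂_term 1 τ (τ := 4 * τ) (by simpa using hτ)).mul_left 4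
    have h' := h.add (summable_pow_mul_jacobiTheta₂_term 0 τ (τ := 4 * τ) (by simpa using hτ))
    refine h'.congr fun m ↦ ?_
    have : jacobiTheta₂_term m τ (4 * τ) = nome τ ^ (2 * m ^ 2 + m) := by
      rw [jacobiTheta₂_term, nome_zpow]; congr 1; push_cast; ring
    rw [this]; ring
  -- With $s=a+b$ and $t=a-b$, $(4a+1)(4b+1)=4(s^2+s)+1-4t^2$; the three summands are the three
  -- terms of the Wronskian.
  have h1 := (summable_mul_int s21 s00).mul_left 4
  have h2 := summable_mul_int s01 s00
  have h3 := (summable_mul_int s01 s20).mul_left 4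
  have h4 := tsum_int_prod_quadratic ((h1.add h2).sub h3) (fun s t ↦ by
    have : (-1 - s) ^ 2 + (-1 - s) = s ^ 2 + s := by ring
    simp only [this]
    push_cast
    ring)
  rw [(h1.add h2).tsum_sub h3, h1.tsum_add h2, tsum_mul_left, tsum_mul_left,
    ← tsum_mul_tsum_int s21 s00, ← tsum_mul_tsum_int s01 s00, ← tsum_mul_tsum_int s01 s20,
    ← phi, ← psi] at h4
  have h5 : euler (nome τ) ^ 6 = euler (nome τ) ^ 3 * euler (nome τ) ^ 3 := by ring
  rw [h5, ← euler_cube hτ, tsum_mul_tsum_int hc hc]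
  refine Eq.trans ?_ (h4.symm.trans (by ring))
  congr 1
  refine tsum_congr fun p ↦ ?_
  have e1 : nome τ ^ (2 * p.1 ^ 2 + p.1) * nome τ ^ (2 * p.2 ^ 2 + p.2) =
      nome τ ^ ((p.1 + p.2) ^ 2 + (p.1 + p.2)) * nome τ ^ ((p.1 - p.2) ^ 2) := by
    rw [← zpow_add₀ hq0, ← zpow_add₀ hq0]; congr 1; ring
  push_cast
  linear_combination (4 * p.1 + 1 : ℂ) * (4 * p.2 + 1) * e1

/-! ### Eta quotient identities, Fricke involutions and the shift by $1/2$. -/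

lemma nome_eq (τ : ℂ) : nome τ = Function.Periodic.qParam 24 τ ^ 24 := by
  rw [nome, Function.Periodic.qParam, ← Complex.exp_nat_mul]
  congr 1; push_cast; ring

lemma etaAt_eq (l : ℕ) (τ : ℂ) :
    etaAt l τ = Function.Periodic.qParam 24 τ ^ l * euler (nome τ ^ l) := by
  rw [etaAt, ModularForm.eta, euler]
  congr 1
  · rw [Function.Periodic.qParam, Function.Periodic.qParam, ← Complex.exp_nat_mul]
    congr 1; ring
  · refine tprod_congr fun n ↦ ?_
    rw [ModularForm.eta_q_eq_pow, nome, ← pow_mul, mul_comm l, pow_mul, mul_left_comm,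
      Complex.exp_nat_mul, ← pow_mul, ← pow_mul, mul_comm l]

lemma etaAt_ne_zero {l : ℕ} (hl : l ≠ 0) {τ : ℂ} (hτ : 0 < τ.im) : etaAt l τ ≠ 0 := by
  refine ModularForm.eta_ne_zero (?_ : 0 < ((l : ℂ) * τ).im)
  rw [← Complex.ofReal_natCast, Complex.im_ofReal_mul]
  exact mul_pos (by exact_mod_cast Nat.pos_of_ne_zero hl) hτ

/-- `φ(q)² - φ(q⁵)²` as an eta quotient. -/
lemma eta_identity_sub {τ : ℂ} (hτ : 0 < τ.im) :
    (etaAt 2 τ ^ 5 / (etaAt 1 τ ^ 2 * etaAt 4 τ ^ 2)) ^ 2 -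
      (etaAt 10 τ ^ 5 / (etaAt 5 τ ^ 2 * etaAt 20 τ ^ 2)) ^ 2 =
    4 * (etaAt 2 τ ^ 2 * etaAt 5 τ * etaAt 20 τ / (etaAt 1 τ * etaAt 4 τ)) := by
  have h := euler_identity (nome_ne_zero τ) (norm_nome_lt_one hτ)
  have he := Function.Periodic.qParam_ne_zero (h := 24) τ
  have hE (l : ℕ) (hl : l ≠ 0) : euler (nome τ ^ l) ≠ 0 :=
    euler_ne_zero (norm_pow_lt_one (norm_nome_lt_one hτ) hl)
  have h1 := hE 1 (by norm_num)
  have h2 := hE 2 (by norm_num)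
  have h4 := hE 4 (by norm_num)
  have h5 := hE 5 (by norm_num)
  have h10 := hE 10 (by norm_num)
  have h20 := hE 20 (by norm_num)
  rw [pow_one] at h1
  simp only [etaAt_eq, pow_one]
  refine Eq.trans ?_ (h.trans ?_)
  · congr 2 <;> field_simp
  · rw [nome_eq τ] at *
    field_simp

/-- The square root of a natural number as a complex number. -/
def natSqrt (m : ℕ) : ℂ := (√(m : ℝ) : ℝ)

lemma natSqrt_sq (m : ℕ) : natSqrt m ^ 2 = m := by
  rw [natSqrt, ← Complex.ofReal_pow, Real.sq_sqrt (Nat.cast_nonneg m), Complex.ofReal_natCast]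

lemma natSqrt_ne_zero {m : ℕ} (hm : m ≠ 0) : natSqrt m ≠ 0 := by
  simpa [natSqrt] using hm

lemma natSqrt_mul (m n : ℕ) : natSqrt (m * n) = natSqrt m * natSqrt n := by
  rw [natSqrt, Nat.cast_mul, Real.sqrt_mul (Nat.cast_nonneg m), Complex.ofReal_mul]; rfl

lemma natSqrt_one : natSqrt 1 = 1 := by simp [natSqrt]

lemma natSqrt_four : natSqrt 4 = 2 := by
  rw [show 4 = 2 * 2 from rfl, natSqrt_mul, ← sq, natSqrt_sq]; norm_num

lemma natSqrt_ten : natSqrt 10 = natSqrt 2 * natSqrt 5 := natSqrt_mul 2 5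

lemma natSqrt_twenty : natSqrt 20 = 2 * natSqrt 5 := by
  rw [← natSqrt_four]; exact natSqrt_mul 4 5

lemma sqrt_natCast_mul {m : ℕ} (hm : m ≠ 0) {τ : ℂ} (hτ : τ ≠ 0) :
    Complex.sqrt (m * τ) = natSqrt m * Complex.sqrt τ := by
  have hm' : (0 : ℝ) < m := by exact_mod_cast Nat.pos_of_ne_zero hm
  rw [sqrt_eq_exp (mul_ne_zero (by exact_mod_cast hm) hτ), sqrt_eq_exp hτ, natSqrt,
    Real.sqrt_eq_rpow, Real.rpow_def_of_pos hm', ← Complex.ofReal_natCast,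
    Complex.log_ofReal_mul hm' hτ, Complex.ofReal_exp, ← Complex.exp_add]
  congr 1; push_cast; ring

/-- Since $l\cdot(-1/(N\tau))=-1/(m\tau)$, this is the inversion formula for $\eta$ at $m\tau$. The
index $l$ becomes $N/l$, and the $\tau$-dependent prefactor is the same for every $l$. -/
lemma etaAt_fricke {l m N : ℕ} (hN : N ≠ 0) (h : l * m = N) {τ : ℂ} (hτ : 0 < τ.im) :
    etaAt l (-1 / (N * τ)) =
      (Complex.sqrt Complex.I)⁻¹ * Complex.sqrt τ * natSqrt m * etaAt m τ := by
  have hm : m ≠ 0 := by rintro rfl; simp at h; exact hN h.symm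
  have hl : (l : ℂ) ≠ 0 := by rintro h'; norm_cast at h'; subst h'; simp at h; exact hN h.symm
  have hτ0 : τ ≠ 0 := by rintro rfl; simp at hτ
  have h1 : (l : ℂ) * (-1 / (N * τ)) = -1 / (m * τ) := by
    rw [← h]; push_cast; field_simp
  have h2 : 0 < ((m : ℂ) * τ).im := by
    rw [← Complex.ofReal_natCast, Complex.im_ofReal_mul]
    exact mul_pos (by exact_mod_cast Nat.pos_of_ne_zero hm) hτ
  have h3 := ModularForm.eta_comp_eq_csqrt_I_inv h2
  simp only [Function.comp, Pi.smul_apply, Pi.mul_apply, smul_eq_mul] at h3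
  rw [etaAt, h1, h3, sqrt_natCast_mul hm hτ0, etaAt]
  ring

lemma im_fricke_pos {N : ℕ} (hN : N ≠ 0) {τ : ℂ} (hτ : 0 < τ.im) : 0 < (-1 / (N * τ)).im := by
  have h : -1 / (N * τ) = ((N : ℝ)⁻¹ : ℝ) * (-τ)⁻¹ := by
    push_cast; rw [neg_div, one_div, mul_inv, inv_neg]; ring
  rw [h, Complex.im_ofReal_mul]
  have := UpperHalfPlane.im_inv_neg_coe_pos ⟨τ, hτ⟩
  have h2 : 0 < (N : ℝ) := by exact_mod_cast Nat.pos_of_ne_zero hN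
  exact mul_pos (inv_pos.mpr h2) this

lemma fricke_factor_ne_zero {τ : ℂ} (hτ : 0 < τ.im) :
    (Complex.sqrt Complex.I)⁻¹ * Complex.sqrt τ ≠ 0 := by
  have : τ ≠ 0 := by rintro rfl; simp at hτ
  simp [Complex.sqrt, this]

/-- `5φ(q⁵)² - φ(q)²` as an eta quotient. -/
lemma eta_identity_sub_five {τ : ℂ} (hτ : 0 < τ.im) :
    5 * (etaAt 10 τ ^ 5 / (etaAt 5 τ ^ 2 * etaAt 20 τ ^ 2)) ^ 2 -
      (etaAt 2 τ ^ 5 / (etaAt 1 τ ^ 2 * etaAt 4 τ ^ 2)) ^ 2 =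
    4 * (etaAt 1 τ * etaAt 4 τ * etaAt 10 τ ^ 2 / (etaAt 5 τ * etaAt 20 τ)) := by
  -- The Fricke involution of level $20$ interchanges $\varphi(q)^2$ and $\varphi(q^5)^2$ up to
  -- constants and a common weight factor.
  have h := eta_identity_sub (im_fricke_pos (N := 20) (by norm_num) hτ)
  have hK := fricke_factor_ne_zero hτ
  have f (l m : ℕ) (hlm : l * m = 20) := etaAt_fricke (by norm_num) hlm hτ
  have hc := natSqrt_sq 2
  have hb := natSqrt_sq 5
  have hb0 := natSqrt_ne_zero (show 5 ≠ 0 by norm_num)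
  rw [f 1 20 rfl, f 2 10 rfl, f 4 5 rfl, f 5 4 rfl, f 10 2 rfl, f 20 1 rfl, natSqrt_one,
    natSqrt_four, natSqrt_ten, natSqrt_twenty] at h
  have a1 := etaAt_ne_zero one_ne_zero hτ
  have a2 := etaAt_ne_zero two_ne_zero hτ
  have a4 := etaAt_ne_zero four_ne_zero hτ
  have a5 := etaAt_ne_zero (show 5 ≠ 0 by norm_num) hτ
  have a10 := etaAt_ne_zero (show 10 ≠ 0 by norm_num) hτ
  have a20 := etaAt_ne_zero (show 20 ≠ 0 by norm_num) hτ
  generalize (Complex.sqrt Complex.I)⁻¹ * Complex.sqrt τ = K at *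
  generalize natSqrt 2 = c at *
  generalize natSqrt 5 = b at *
  generalize etaAt 1 τ = x1 at *
  generalize etaAt 2 τ = x2 at *
  generalize etaAt 4 τ = x4 at *
  generalize etaAt 5 τ = x5 at *
  generalize etaAt 10 τ = x10 at *
  generalize etaAt 20 τ = x20 at *
  have e1 : ((K * (c * b) * x10) ^ 5 / ((K * (2 * b) * x20) ^ 2 * (K * b * x5) ^ 2)) ^ 2 =
      K ^ 2 * ((c ^ 2) ^ 5 * b ^ 2 / 16) * (x10 ^ 5 / (x5 ^ 2 * x20 ^ 2)) ^ 2 := by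
    field_simp; ring
  have e2 : ((K * c * x2) ^ 5 / ((K * 2 * x4) ^ 2 * (K * 1 * x1) ^ 2)) ^ 2 =
      K ^ 2 * ((c ^ 2) ^ 5 / 16) * (x2 ^ 5 / (x1 ^ 2 * x4 ^ 2)) ^ 2 := by
    field_simp; ring
  have e3 : 4 * ((K * (c * b) * x10) ^ 2 * (K * 2 * x4) * (K * 1 * x1) /
      (K * (2 * b) * x20 * (K * b * x5))) =
      K ^ 2 * (4 * c ^ 2) * (x1 * x4 * x10 ^ 2 / (x5 * x20)) := by
    field_simp
  rw [e1, e2, e3, hc, hb] at h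
  push_cast at h
  apply mul_left_cancel₀ (pow_ne_zero 2 hK)
  linear_combination h / 2

lemma nome_add_half (τ : ℂ) : nome (τ + 1 / 2) = -nome τ := by
  rw [nome, mul_add, Complex.exp_add, show 2 * (Real.pi : ℂ) * Complex.I * (1 / 2) =
    Real.pi * Complex.I by ring, Complex.exp_pi_mul_I, mul_neg_one, nome]

lemma im_add_half {τ : ℂ} (hτ : 0 < τ.im) : 0 < (τ + 1 / 2).im := by simpa using hτ

lemma qParam_add (h : ℝ) (z w : ℂ) : Function.Periodic.qParam h (z + w) =
    Function.Periodic.qParam h z * Function.Periodic.qParam h w := by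
  simp only [Function.Periodic.qParam]
  rw [← Complex.exp_add]
  congr 1; ring

lemma etaAt_add_half_of_even {l : ℕ} (hl : Even l) (τ : ℂ) :
    etaAt l (τ + 1 / 2) = Function.Periodic.qParam 24 (1 / 2) ^ l * etaAt l τ := by
  rw [etaAt_eq, etaAt_eq, nome_add_half, hl.neg_pow, qParam_add, mul_pow]
  ring

lemma etaAt_add_half_of_odd {l : ℕ} (hl : Odd l) {τ : ℂ} (hτ : 0 < τ.im) :
    etaAt l (τ + 1 / 2) = Function.Periodic.qParam 24 (1 / 2) ^ l *
      (etaAt (2 * l) τ ^ 3 / (etaAt l τ * etaAt (4 * l) τ)) := by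
  have hl0 : l ≠ 0 := hl.pos.ne'
  have he := Function.Periodic.qParam_ne_zero (h := 24) τ
  have hq := norm_pow_lt_one (norm_nome_lt_one hτ) hl0
  have h := euler_neg hq
  have h1 := euler_ne_zero hq
  have h2 := euler_ne_zero (norm_pow_lt_one hq four_ne_zero)
  rw [← eq_div_iff (mul_ne_zero h1 h2)] at h
  rw [etaAt_eq, etaAt_eq, etaAt_eq, etaAt_eq, nome_add_half, hl.neg_pow, h,
    qParam_add, mul_comm 2 l, mul_comm 4 l, pow_mul, pow_mul, mul_pow]
  simp only [pow_mul]
  field_simp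

lemma qParam_half_pow : Function.Periodic.qParam 24 (1 / 2) ^ 24 = -1 := by
  rw [← nome_eq, nome, ← Complex.exp_pi_mul_I]; congr 1; ring

/-- `φ(-q)² - φ(-q⁵)²` as an eta quotient. -/
lemma eta_identity_neg_sub {τ : ℂ} (hτ : 0 < τ.im) :
    (etaAt 1 τ ^ 2 / etaAt 2 τ) ^ 2 - (etaAt 5 τ ^ 2 / etaAt 10 τ) ^ 2 =
      -4 * (etaAt 1 τ * etaAt 10 τ ^ 3 / (etaAt 2 τ * etaAt 5 τ)) := by
  have h := eta_identity_sub (im_add_half hτ)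
  have hw := Function.Periodic.qParam_ne_zero (h := 24) (1 / 2)
  have hw24 := qParam_half_pow
  rw [etaAt_add_half_of_odd (l := 1) (by decide) hτ, etaAt_add_half_of_odd (l := 5) (by decide) hτ,
    etaAt_add_half_of_even (l := 2) (by decide), etaAt_add_half_of_even (l := 4) (by decide),
    etaAt_add_half_of_even (l := 10) (by decide), etaAt_add_half_of_even (l := 20) (by decide)] at h
  simp only [Nat.reduceMul] at h
  have a1 := etaAt_ne_zero one_ne_zero hτ
  have a2 := etaAt_ne_zero two_ne_zero hτ
  have a4 := etaAt_ne_zero four_ne_zero hτ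
  have a5 := etaAt_ne_zero (show 5 ≠ 0 by norm_num) hτ
  have a10 := etaAt_ne_zero (show 10 ≠ 0 by norm_num) hτ
  have a20 := etaAt_ne_zero (show 20 ≠ 0 by norm_num) hτ
  generalize Function.Periodic.qParam 24 (1 / 2) = w at *
  generalize etaAt 1 τ = x1 at *
  generalize etaAt 2 τ = x2 at *
  generalize etaAt 4 τ = x4 at *
  generalize etaAt 5 τ = x5 at *
  generalize etaAt 10 τ = x10 at *
  generalize etaAt 20 τ = x20 at *
  have e1 : ((w ^ 2 * x2) ^ 5 / ((w ^ 1 * (x2 ^ 3 / (x1 * x4))) ^ 2 * (w ^ 4 * x4) ^ 2)) ^ 2 =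
      (x1 ^ 2 / x2) ^ 2 := by
    field_simp
  have e2 : ((w ^ 10 * x10) ^ 5 / ((w ^ 5 * (x10 ^ 3 / (x5 * x20))) ^ 2 * (w ^ 20 * x20) ^ 2)) ^ 2 =
      (x5 ^ 2 / x10) ^ 2 := by
    field_simp
  -- The powers of $w$ cancel on the left-hand side but leave $w^{24}=-1$ here: this is the factor
  -- $q$ changing sign.
  have e3 : 4 * ((w ^ 2 * x2) ^ 2 * (w ^ 5 * (x10 ^ 3 / (x5 * x20))) * (w ^ 20 * x20) /
      (w ^ 1 * (x2 ^ 3 / (x1 * x4)) * (w ^ 4 * x4))) =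
      w ^ 24 * (4 * (x1 * x10 ^ 3 / (x2 * x5))) := by
    field_simp
  rw [e1, e2, e3, hw24] at h
  rw [h]; ring

/-- `5φ(-q⁵)² - φ(-q)²` as an eta quotient. -/
lemma eta_identity_neg_sub_five {τ : ℂ} (hτ : 0 < τ.im) :
    5 * (etaAt 5 τ ^ 2 / etaAt 10 τ) ^ 2 - (etaAt 1 τ ^ 2 / etaAt 2 τ) ^ 2 =
      4 * (etaAt 2 τ ^ 3 * etaAt 5 τ / (etaAt 1 τ * etaAt 10 τ)) := by
  have h := eta_identity_sub_five (im_add_half hτ)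
  have hw := Function.Periodic.qParam_ne_zero (h := 24) (1 / 2)
  have hw24 := qParam_half_pow
  rw [etaAt_add_half_of_odd (l := 1) (by decide) hτ, etaAt_add_half_of_odd (l := 5) (by decide) hτ,
    etaAt_add_half_of_even (l := 2) (by decide), etaAt_add_half_of_even (l := 4) (by decide),
    etaAt_add_half_of_even (l := 10) (by decide), etaAt_add_half_of_even (l := 20) (by decide)] at h
  simp only [Nat.reduceMul] at h
  have a1 := etaAt_ne_zero one_ne_zero hτ
  have a2 := etaAt_ne_zero two_ne_zero hτ
  have a4 := etaAt_ne_zero four_ne_zero hτ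
  have a5 := etaAt_ne_zero (show 5 ≠ 0 by norm_num) hτ
  have a10 := etaAt_ne_zero (show 10 ≠ 0 by norm_num) hτ
  have a20 := etaAt_ne_zero (show 20 ≠ 0 by norm_num) hτ
  generalize Function.Periodic.qParam 24 (1 / 2) = w at *
  generalize etaAt 1 τ = x1 at *
  generalize etaAt 2 τ = x2 at *
  generalize etaAt 4 τ = x4 at *
  generalize etaAt 5 τ = x5 at *
  generalize etaAt 10 τ = x10 at *
  generalize etaAt 20 τ = x20 at *
  have e1 : ((w ^ 2 * x2) ^ 5 / ((w ^ 1 * (x2 ^ 3 / (x1 * x4))) ^ 2 * (w ^ 4 * x4) ^ 2)) ^ 2 =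
      (x1 ^ 2 / x2) ^ 2 := by
    field_simp
  have e2 : ((w ^ 10 * x10) ^ 5 / ((w ^ 5 * (x10 ^ 3 / (x5 * x20))) ^ 2 * (w ^ 20 * x20) ^ 2)) ^ 2 =
      (x5 ^ 2 / x10) ^ 2 := by
    field_simp
  have e3 : 4 * ((w ^ 1 * (x2 ^ 3 / (x1 * x4))) * (w ^ 4 * x4) * (w ^ 10 * x10) ^ 2 /
      (w ^ 5 * (x10 ^ 3 / (x5 * x20)) * (w ^ 20 * x20))) =
      4 * (x2 ^ 3 * x5 / (x1 * x10)) := by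
    field_simp
  rw [e1, e2, e3] at h
  exact h

/-- `ψ(q)² - qψ(q⁵)²` as an eta quotient. -/
lemma eta_identity_psi {τ : ℂ} (hτ : 0 < τ.im) :
    (etaAt 2 τ ^ 2 / etaAt 1 τ) ^ 2 - (etaAt 10 τ ^ 2 / etaAt 5 τ) ^ 2 =
      etaAt 2 τ * etaAt 5 τ ^ 3 / (etaAt 1 τ * etaAt 10 τ) := by
  -- At level $10$ the Fricke involution turns $\eta_1^2/\eta_2$, which is $\varphi(-q)$, into a
  -- multiple of $\eta_{10}^2/\eta_5$.
  have h := eta_identity_neg_sub_five (im_fricke_pos (N := 10) (by norm_num) hτ)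
  have hK := fricke_factor_ne_zero hτ
  have f (l m : ℕ) (hlm : l * m = 10) := etaAt_fricke (by norm_num) hlm hτ
  have hc := natSqrt_sq 2
  have hb := natSqrt_sq 5
  have hc0 := natSqrt_ne_zero two_ne_zero
  have hb0 := natSqrt_ne_zero (show 5 ≠ 0 by norm_num)
  rw [f 1 10 rfl, f 2 5 rfl, f 5 2 rfl, f 10 1 rfl, natSqrt_one, natSqrt_ten] at h
  have a1 := etaAt_ne_zero one_ne_zero hτ
  have a2 := etaAt_ne_zero two_ne_zero hτ
  have a5 := etaAt_ne_zero (show 5 ≠ 0 by norm_num) hτ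
  have a10 := etaAt_ne_zero (show 10 ≠ 0 by norm_num) hτ
  generalize (Complex.sqrt Complex.I)⁻¹ * Complex.sqrt τ = K at *
  generalize natSqrt 2 = c at *
  generalize natSqrt 5 = b at *
  generalize etaAt 1 τ = x1 at *
  generalize etaAt 2 τ = x2 at *
  generalize etaAt 5 τ = x5 at *
  generalize etaAt 10 τ = x10 at *
  have e1 : ((K * c * x2) ^ 2 / (K * 1 * x1)) ^ 2 = K ^ 2 * (c ^ 2) ^ 2 * (x2 ^ 2 / x1) ^ 2 := by
    field_simp
  have e2 : ((K * (c * b) * x10) ^ 2 / (K * b * x5)) ^ 2 =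
      K ^ 2 * ((c ^ 2) ^ 2 * b ^ 2) * (x10 ^ 2 / x5) ^ 2 := by
    field_simp
  have e3 : 4 * ((K * b * x5) ^ 3 * (K * c * x2) / (K * (c * b) * x10 * (K * 1 * x1))) =
      K ^ 2 * (4 * b ^ 2) * (x2 * x5 ^ 3 / (x1 * x10)) := by
    field_simp
  rw [e1, e2, e3, hc, hb] at h
  push_cast at h
  apply mul_left_cancel₀ (pow_ne_zero 2 hK)
  linear_combination h / 20

/-- `ψ(q)² - 5qψ(q⁵)²` as an eta quotient. -/
lemma eta_identity_psi_five {τ : ℂ} (hτ : 0 < τ.im) :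
    (etaAt 2 τ ^ 2 / etaAt 1 τ) ^ 2 - 5 * (etaAt 10 τ ^ 2 / etaAt 5 τ) ^ 2 =
      etaAt 1 τ ^ 3 * etaAt 10 τ / (etaAt 2 τ * etaAt 5 τ) := by
  have h := eta_identity_neg_sub (im_fricke_pos (N := 10) (by norm_num) hτ)
  have hK := fricke_factor_ne_zero hτ
  have f (l m : ℕ) (hlm : l * m = 10) := etaAt_fricke (by norm_num) hlm hτ
  have hc := natSqrt_sq 2
  have hb := natSqrt_sq 5
  have hc0 := natSqrt_ne_zero two_ne_zero
  have hb0 := natSqrt_ne_zero (show 5 ≠ 0 by norm_num)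
  rw [f 1 10 rfl, f 2 5 rfl, f 5 2 rfl, f 10 1 rfl, natSqrt_one, natSqrt_ten] at h
  have a1 := etaAt_ne_zero one_ne_zero hτ
  have a2 := etaAt_ne_zero two_ne_zero hτ
  have a5 := etaAt_ne_zero (show 5 ≠ 0 by norm_num) hτ
  have a10 := etaAt_ne_zero (show 10 ≠ 0 by norm_num) hτ
  generalize (Complex.sqrt Complex.I)⁻¹ * Complex.sqrt τ = K at *
  generalize natSqrt 2 = c at *
  generalize natSqrt 5 = b at *
  generalize etaAt 1 τ = x1 at *
  generalize etaAt 2 τ = x2 at *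
  generalize etaAt 5 τ = x5 at *
  generalize etaAt 10 τ = x10 at *
  have e1 : ((K * c * x2) ^ 2 / (K * 1 * x1)) ^ 2 = K ^ 2 * (c ^ 2) ^ 2 * (x2 ^ 2 / x1) ^ 2 := by
    field_simp
  have e2 : ((K * (c * b) * x10) ^ 2 / (K * b * x5)) ^ 2 =
      K ^ 2 * ((c ^ 2) ^ 2 * b ^ 2) * (x10 ^ 2 / x5) ^ 2 := by
    field_simp
  have e3 : -4 * ((K * (c * b) * x10) * (K * 1 * x1) ^ 3 / (K * b * x5 * (K * c * x2))) =
      -4 * K ^ 2 * (x1 ^ 3 * x10 / (x2 * x5)) := by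
    field_simp
  rw [e1, e2, e3, hc, hb] at h
  push_cast at h
  apply mul_left_cancel₀ (pow_ne_zero 2 hK)
  linear_combination -h / 4

/-! ### Logarithmic derivatives and the four squares identity. -/

lemma E2_eq_P (τ : UpperHalfPlane) : EisensteinSeries.E2 τ = P (nome τ) := by
  rw [EisensteinSeries.E2_eq_tsum_cexp, P, nome, ← tsum_pow_div_one_sub_eq_tsum_sigma
    (UpperHalfPlane.norm_exp_two_pi_I_lt_one τ), tsum_pnat_eq_tsum_succ (f := fun n ↦
    (n : ℂ) ^ 1 * Complex.exp (2 * Real.pi * Complex.I * τ) ^ n /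
      (1 - Complex.exp (2 * Real.pi * Complex.I * τ) ^ n))]
  simp

/-- `f` has logarithmic derivative `a` at `τ`, where vanishing of `f τ` is not excluded. -/
def HasLogDerivAt (f : ℂ → ℂ) (a τ : ℂ) : Prop := HasDerivAt f (f τ * a) τ

namespace HasLogDerivAt

variable {f g : ℂ → ℂ} {a b τ : ℂ}

lemma mul (hf : HasLogDerivAt f a τ) (hg : HasLogDerivAt g b τ) :
    HasLogDerivAt (fun x ↦ f x * g x) (a + b) τ := by
  refine (HasDerivAt.mul hf hg).congr_deriv ?_
  ring

lemma pow (hf : HasLogDerivAt f a τ) (n : ℕ) : HasLogDerivAt (fun x ↦ f x ^ n) (n * a) τ := by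
  refine (HasDerivAt.fun_pow hf n).congr_deriv ?_
  rcases n with _ | n
  · simp
  · simp only [Nat.add_sub_cancel]; ring

lemma div (hf : HasLogDerivAt f a τ) (hg : HasLogDerivAt g b τ) (h : g τ ≠ 0) :
    HasLogDerivAt (fun x ↦ f x / g x) (a - b) τ := by
  refine (HasDerivAt.fun_div hf hg h).congr_deriv ?_
  field_simp

lemma const_mul (hf : HasLogDerivAt f a τ) (c : ℂ) : HasLogDerivAt (fun x ↦ c * f x) a τ := by
  refine (HasDerivAt.const_mul c hf).congr_deriv ?_
  ring

lemma congr_of_im_pos (hτ : 0 < τ.im) (hf : HasLogDerivAt f a τ)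
    (h : ∀ x : ℂ, 0 < x.im → g x = f x) : HasLogDerivAt g a τ := by
  rw [HasLogDerivAt, h τ hτ]
  refine HasDerivAt.congr_of_eventuallyEq hf ?_
  filter_upwards [UpperHalfPlane.isOpen_upperHalfPlaneSet.mem_nhds hτ] with x hx using h x hx

lemma unique (hf : HasLogDerivAt f a τ) (hg : HasLogDerivAt f b τ) (h : f τ ≠ 0) : a = b :=
  mul_left_cancel₀ h (HasDerivAt.unique hf hg)

end HasLogDerivAt

lemma hasLogDerivAt_etaAt {l : ℕ} (hl : l ≠ 0) {τ : ℂ} (hτ : 0 < τ.im) :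
    HasLogDerivAt (etaAt l) (2 * Real.pi * Complex.I * (l / 24 * PAt l τ)) τ := by
  have h2 : 0 < ((l : ℂ) * τ).im := by
    rw [← Complex.ofReal_natCast, Complex.im_ofReal_mul]
    exact mul_pos (by exact_mod_cast Nat.pos_of_ne_zero hl) hτ
  have h3 := ModularForm.logDeriv_eta_eq_E2 ⟨(l : ℂ) * τ, h2⟩
  rw [E2_eq_P, logDeriv_apply, UpperHalfPlane.coe_mk, div_eq_iff (ModularForm.eta_ne_zero h2)] at h3
  have h4 := (ModularForm.differentiableAt_eta_of_mem_upperHalfPlaneSet h2).hasDerivAt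
  have h5 := h4.comp τ ((hasDerivAt_id τ).const_mul (l : ℂ))
  refine h5.congr_deriv ?_
  have h6 : nome (l * τ) = nome τ ^ l := by
    rw [nome, nome, ← Complex.exp_nat_mul]; congr 1; ring
  rw [h3, PAt, etaAt, h6]
  ring

lemma PAt_nat_mul (k l : ℕ) (τ : ℂ) : PAt l (k * τ) = PAt (k * l) τ := by
  rw [PAt, PAt, pow_mul, nome, nome, ← Complex.exp_nat_mul _ k]; congr 3; ring

lemma etaAt_nat_mul (k l : ℕ) (τ : ℂ) : etaAt l (k * τ) = etaAt (k * l) τ := by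
  rw [etaAt, etaAt]; push_cast; congr 1; ring

lemma phi_nome {τ : ℂ} (hτ : 0 < τ.im) :
    phi (nome τ) = etaAt 2 τ ^ 5 / (etaAt 1 τ ^ 2 * etaAt 4 τ ^ 2) := by
  have he := Function.Periodic.qParam_ne_zero (h := 24) τ
  rw [phi_eq (nome_ne_zero τ) (norm_nome_lt_one hτ), etaAt_eq, etaAt_eq, etaAt_eq, pow_one, pow_one]
  have h1 := euler_ne_zero (norm_nome_lt_one hτ)
  have h4 := euler_ne_zero (norm_pow_lt_one (norm_nome_lt_one hτ) four_ne_zero)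
  field_simp

lemma psi_nome {τ : ℂ} (hτ : 0 < τ.im) :
    psi (nome τ) = 2 * (etaAt 4 τ ^ 2 / etaAt 2 τ) / Function.Periodic.qParam 24 τ ^ 6 := by
  have he := Function.Periodic.qParam_ne_zero (h := 24) τ
  rw [psi_eq (nome_ne_zero τ) (norm_nome_lt_one hτ), etaAt_eq, etaAt_eq]
  have h2 := euler_ne_zero (norm_pow_lt_one (norm_nome_lt_one hτ) two_ne_zero)
  field_simp

lemma hasLogDerivAt_qParam (τ : ℂ) :
    HasLogDerivAt (Function.Periodic.qParam 24) (2 * Real.pi * Complex.I / 24) τ := by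
  have := ((hasDerivAt_id τ).const_mul (2 * Real.pi * Complex.I)).div_const ((24 : ℝ) : ℂ)
  refine this.cexp.congr_deriv ?_
  simp [Function.Periodic.qParam]

/-- Differentiating the eta quotients for `phi` and `psi` expresses the series in the Wronskian
`euler_pow_six` through $P_1,P_2,P_4$. The $1/4$ below comes from the factor $q^{-1/4}$ in
`psi_nome` and cancels the middle term there. -/
lemma eisenstein_eq_phi_neg_pow {τ : ℂ} (hτ : 0 < τ.im) :
    8 * PAt 4 τ + PAt 1 τ - 6 * PAt 2 τ = 3 * (etaAt 1 τ ^ 8 / etaAt 2 τ ^ 4) := by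
  have l1 := hasLogDerivAt_etaAt one_ne_zero hτ
  have l2 := hasLogDerivAt_etaAt two_ne_zero hτ
  have l4 := hasLogDerivAt_etaAt four_ne_zero hτ
  have a1 := etaAt_ne_zero one_ne_zero hτ
  have a2 := etaAt_ne_zero two_ne_zero hτ
  have a4 := etaAt_ne_zero four_ne_zero hτ
  have he := Function.Periodic.qParam_ne_zero (h := 24) τ
  have d1 := ((l2.pow 5).div ((l1.pow 2).mul (l4.pow 2)) (by simp [a1, a4])).congr_of_im_pos hτ
    (g := fun τ ↦ phi (nome τ)) fun x hx ↦ phi_nome hx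
  have d2 := ((((l4.pow 2).div l2 a2).const_mul 2).div ((hasLogDerivAt_qParam τ).pow 6)
    (by simp [he])).congr_of_im_pos hτ (g := fun τ ↦ psi (nome τ)) fun x hx ↦ psi_nome hx
  have d3 := hasDerivAt_tsum_nome 0 hτ
  have d4 := hasDerivAt_tsum_nome 1 hτ
  simp only [Int.cast_zero, zero_mul, add_zero, Int.cast_one, one_mul] at d3 d4
  have e1 := HasDerivAt.unique d1 d3
  have e2 := HasDerivAt.unique d2 d4
  have h := euler_pow_six hτ
  have hp := phi_nome hτ
  have hs := psi_nome hτ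
  have h1 : etaAt 1 τ = Function.Periodic.qParam 24 τ * euler (nome τ) := by
    simpa using etaAt_eq 1 τ
  set S1 := ∑' n : ℤ, ((n : ℂ) ^ 2 + n) * nome τ ^ (n ^ 2 + n)
  set S0 := ∑' n : ℤ, (n : ℂ) ^ 2 * nome τ ^ (n ^ 2)
  have e1' : S0 = phi (nome τ) * ((10 * PAt 2 τ - 2 * PAt 1 τ - 8 * PAt 4 τ) / 24) := by
    apply mul_left_cancel₀ Complex.two_pi_I_ne_zero
    rw [← e1]; push_cast; ring
  have e2' : S1 = psi (nome τ) * ((8 * PAt 4 τ - 2 * PAt 2 τ) / 24 - 1 / 4) := by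
    apply mul_left_cancel₀ Complex.two_pi_I_ne_zero
    rw [← e2]; push_cast; ring
  rw [e1', e2'] at h
  have h2 : 6 * euler (nome τ) ^ 6 = psi (nome τ) * phi (nome τ) *
      (8 * PAt 4 τ + PAt 1 τ - 6 * PAt 2 τ) := by linear_combination 3 * h
  rw [hp, hs] at h2
  generalize 8 * PAt 4 τ + PAt 1 τ - 6 * PAt 2 τ = X at *
  have h3 : euler (nome τ) = etaAt 1 τ / Function.Periodic.qParam 24 τ := by
    rw [h1]; field_simp
  rw [h3] at h2
  field_simp at h2 ⊢
  linear_combination -h2 / 2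

lemma PAt_one_add_half {τ : ℂ} (hτ : 0 < τ.im) :
    PAt 1 (τ + 1 / 2) = 6 * PAt 2 τ - PAt 1 τ - 4 * PAt 4 τ := by
  have l1 := hasLogDerivAt_etaAt one_ne_zero hτ
  have l2 := hasLogDerivAt_etaAt two_ne_zero hτ
  have l4 := hasLogDerivAt_etaAt four_ne_zero hτ
  have a1 := etaAt_ne_zero one_ne_zero hτ
  have a4 := etaAt_ne_zero four_ne_zero hτ
  have d1 := (((l2.pow 3).div (l1.mul l4) (by simp [a1, a4])).const_mul
    (Function.Periodic.qParam 24 (1 / 2) ^ 1)).congr_of_im_pos hτ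
    (g := fun τ ↦ etaAt 1 (τ + 1 / 2)) fun x hx ↦ etaAt_add_half_of_odd odd_one hx
  have d2 := (hasLogDerivAt_etaAt one_ne_zero (im_add_half hτ)).comp_add_const τ (1 / 2)
  have h := HasLogDerivAt.unique d2 d1 (etaAt_ne_zero one_ne_zero (im_add_half hτ))
  push_cast at h
  apply mul_left_cancel₀ Complex.two_pi_I_ne_zero
  linear_combination 24 * h

lemma PAt_add_half_of_even {l : ℕ} (hl : Even l) (τ : ℂ) : PAt l (τ + 1 / 2) = PAt l τ := by
  rw [PAt, PAt, nome_add_half, hl.neg_pow]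

/-- Jacobi's four squares identity. -/
lemma eisenstein_eq_phi_pow {τ : ℂ} (hτ : 0 < τ.im) :
    4 * PAt 4 τ - PAt 1 τ = 3 * (etaAt 2 τ ^ 5 / (etaAt 1 τ ^ 2 * etaAt 4 τ ^ 2)) ^ 4 := by
  -- Replacing $q$ by $-q$ turns $\varphi(-q)^4$ into $\varphi(q)^4$, and $P_2$ drops out.
  have h := eisenstein_eq_phi_neg_pow (im_add_half hτ)
  have hw := Function.Periodic.qParam_ne_zero (h := 24) (1 / 2)
  rw [PAt_one_add_half hτ, PAt_add_half_of_even (by decide), PAt_add_half_of_even (by decide),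
    etaAt_add_half_of_odd odd_one hτ, etaAt_add_half_of_even even_two] at h
  have a1 := etaAt_ne_zero one_ne_zero hτ
  have a2 := etaAt_ne_zero two_ne_zero hτ
  have a4 := etaAt_ne_zero four_ne_zero hτ
  refine Eq.trans (by ring) (h.trans ?_)
  simp only [mul_one]
  field_simp

lemma eisenstein_eq_phi_pow_five {τ : ℂ} (hτ : 0 < τ.im) :
    4 * PAt 20 τ - PAt 5 τ = 3 * (etaAt 10 τ ^ 5 / (etaAt 5 τ ^ 2 * etaAt 20 τ ^ 2)) ^ 4 := by
  have h := eisenstein_eq_phi_pow (τ := (5 : ℕ) * τ) (by simpa using hτ)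
  simpa only [PAt_nat_mul, etaAt_nat_mul, Nat.reduceMul] using h

/-! ### Behaviour at the cusp and cancellation of holomorphic factors. -/

lemma continuousAt_euler {f : ℂ → ℂ} (hf : ContinuousAt f 0) (h0 : f 0 = 0) :
    ContinuousAt (fun q ↦ euler (f q)) 0 := by
  have h : ContinuousAt euler (f 0) := by
    rw [h0]
    exact (ModularForm.differentiableOn_tprod_one_sub_pow.differentiableAt
      (Metric.isOpen_ball.mem_nhds (Metric.mem_ball_self one_pos))).continuousAt
  exact ContinuousAt.comp' h hf

lemma v_eq {τ : ℂ} (hτ : 0 < τ.im) :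
    v τ = nome τ * (euler (nome τ ^ 2) * euler (nome τ ^ 5) * euler (nome τ ^ 20) /
      (euler (nome τ) * euler (nome τ ^ 4) * euler (nome τ ^ 10))) ^ 2 := by
  have he := Function.Periodic.qParam_ne_zero (h := 24) τ
  have hE (l : ℕ) (hl : l ≠ 0) : euler (nome τ ^ l) ≠ 0 :=
    euler_ne_zero (norm_pow_lt_one (norm_nome_lt_one hτ) hl)
  have h1 := hE 1 (by norm_num)
  have h4 := hE 4 (by norm_num)
  have h10 := hE 10 (by norm_num)
  simp only [v, etaAt_eq, pow_one] at *
  generalize euler (nome τ) = E1 at *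
  generalize euler (nome τ ^ 4) = E4 at *
  generalize euler (nome τ ^ 10) = E10 at *
  rw [nome_eq τ]
  field_simp

lemma u_eq {τ : ℂ} (hτ : 0 < τ.im) :
    u τ = nome τ * (euler (nome τ) * euler (nome τ ^ 20) /
      (euler (nome τ ^ 4) * euler (nome τ ^ 5))) ^ 2 := by
  have he := Function.Periodic.qParam_ne_zero (h := 24) τ
  have hE (l : ℕ) (hl : l ≠ 0) : euler (nome τ ^ l) ≠ 0 :=
    euler_ne_zero (norm_pow_lt_one (norm_nome_lt_one hτ) hl)
  have h4 := hE 4 (by norm_num)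
  have h5 := hE 5 (by norm_num)
  simp only [u, etaAt_eq, pow_one] at *
  generalize euler (nome τ ^ 4) = E4 at *
  generalize euler (nome τ ^ 5) = E5 at *
  rw [nome_eq τ]
  field_simp

/-- Near the cusp at infinity both `u` and `v` are small. -/
lemma exists_norm_u_v_lt {ε : ℝ} (hε : 0 < ε) :
    ∃ τ : ℂ, 0 < τ.im ∧ ‖u τ‖ < ε ∧ ‖v τ‖ < ε := by
  have hc (l : ℕ) (hl : l ≠ 0) : ContinuousAt (fun q : ℂ ↦ euler (q ^ l)) 0 :=
    continuousAt_euler (by fun_prop) (by simp [hl])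
  have hE : euler 0 ≠ 0 := euler_ne_zero (by simp)
  have c1 := hc 1 (by norm_num)
  have c2 := hc 2 (by norm_num)
  have c4 := hc 4 (by norm_num)
  have c5 := hc 5 (by norm_num)
  have c10 := hc 10 (by norm_num)
  have c20 := hc 20 (by norm_num)
  simp only [pow_one] at c1
  have hu : Tendsto (fun q : ℂ ↦ q * (euler q * euler (q ^ 20) /
      (euler (q ^ 4) * euler (q ^ 5))) ^ 2) (𝓝 0) (𝓝 0) := by
    have := continuousAt_id.mul (((c1.mul c20).div (c4.mul c5) (by simp [hE])).pow 2)
    simpa [ContinuousAt] using! this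
  have hv : Tendsto (fun q : ℂ ↦ q * (euler (q ^ 2) * euler (q ^ 5) * euler (q ^ 20) /
      (euler q * euler (q ^ 4) * euler (q ^ 10))) ^ 2) (𝓝 0) (𝓝 0) := by
    have := continuousAt_id.mul ((((c2.mul c5).mul c20).div ((c1.mul c4).mul c10)
      (by simp [hE])).pow 2)
    simpa [ContinuousAt] using! this
  have h1 := (hu.eventually (Metric.ball_mem_nhds 0 hε)).filter_mono
    (nhdsWithin_le_nhds (s := {0}ᶜ))
  have h2 := (hv.eventually (Metric.ball_mem_nhds 0 hε)).filter_mono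
    (nhdsWithin_le_nhds (s := {0}ᶜ))
  have h3 : ∀ᶠ q in 𝓝[≠] (0 : ℂ), q ∈ Metric.ball (0 : ℂ) 1 :=
    mem_nhdsWithin_of_mem_nhds (Metric.ball_mem_nhds (0 : ℂ) one_pos)
  obtain ⟨q, ⟨⟨hqu, hqv⟩, hq1⟩, hq0⟩ := (((h1.and h2).and h3).and self_mem_nhdsWithin).exists
  have him := Function.Periodic.im_invQParam_pos_of_norm_lt_one one_pos
    (by simpa using hq1) hq0
  have hn : nome (Function.Periodic.invQParam 1 q) = q := by
    have := Function.Periodic.qParam_right_inv one_ne_zero hq0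
    simpa [nome, Function.Periodic.qParam] using this
  refine ⟨_, him, ?_, ?_⟩
  · rw [u_eq him, hn]; simpa using hqu
  · rw [v_eq him, hn]; simpa using hqv

lemma differentiableAt_etaAt {l : ℕ} (hl : l ≠ 0) {τ : ℂ} (hτ : 0 < τ.im) :
    DifferentiableAt ℂ (etaAt l) τ :=
  HasDerivAt.differentiableAt (hasLogDerivAt_etaAt hl hτ)

/-- Up to a constant this is the logarithmic derivative of a nonvanishing holomorphic function, so
the series need not be differentiated. -/
lemma differentiableAt_PAt {l : ℕ} (hl : l ≠ 0) {τ : ℂ} (hτ : 0 < τ.im) :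
    DifferentiableAt ℂ (PAt l) τ := by
  have h : DifferentiableOn ℂ (etaAt l) UpperHalfPlane.upperHalfPlaneSet :=
    fun x hx ↦ (differentiableAt_etaAt hl hx).differentiableWithinAt
  have hmem := UpperHalfPlane.isOpen_upperHalfPlaneSet.mem_nhds hτ
  have h1 := (h.deriv UpperHalfPlane.isOpen_upperHalfPlaneSet).differentiableAt hmem
  have h2 := (h1.div (differentiableAt_etaAt hl hτ) (etaAt_ne_zero hl hτ)).const_mul
    (24 / (2 * Real.pi * Complex.I * l))
  refine h2.congr_of_eventuallyEq ?_
  filter_upwards [hmem] with x hx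
  have h3 := etaAt_ne_zero hl hx
  have h4 := Complex.two_pi_I_ne_zero
  have h5 : (l : ℂ) ≠ 0 := by exact_mod_cast hl
  rw [Pi.div_apply, HasDerivAt.deriv (hasLogDerivAt_etaAt hl hx), mul_div_cancel_left₀ _ h3]
  field_simp

lemma eq_zero_of_mul_eq_zero {f g : ℂ → ℂ}
    (hf : ∀ τ : ℂ, 0 < τ.im → DifferentiableAt ℂ f τ)
    (hg : ∀ τ : ℂ, 0 < τ.im → DifferentiableAt ℂ g τ)
    (h : ∀ τ : ℂ, 0 < τ.im → f τ * g τ = 0) (hf0 : ∃ τ : ℂ, 0 < τ.im ∧ f τ ≠ 0)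
    {τ : ℂ} (hτ : 0 < τ.im) : g τ = 0 := by
  have han {f : ℂ → ℂ} (hf : ∀ τ : ℂ, 0 < τ.im → DifferentiableAt ℂ f τ) :
      AnalyticOnNhd ℂ f UpperHalfPlane.upperHalfPlaneSet :=
    DifferentiableOn.analyticOnNhd (fun x hx ↦ (hf x hx).differentiableWithinAt)
      UpperHalfPlane.isOpen_upperHalfPlaneSet
  obtain ⟨σ, hσ, hne⟩ := hf0
  rcases AnalyticOnNhd.eq_zero_or_eq_zero_of_mul_eq_zero (han hf) (han hg) (fun x hx ↦ h x hx)
    (convex_halfSpace_im_gt 0).isPreconnected with h1 | h1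
  · exact absurd (h1 σ hσ) hne
  · exact h1 τ hτ

/-! ### The relation between $u$ and $v$ and its derivative. -/

lemma hasLogDerivAt_u {τ : ℂ} (hτ : 0 < τ.im) :
    HasLogDerivAt u (2 * Real.pi * Complex.I *
      ((PAt 1 τ + 20 * PAt 20 τ - 4 * PAt 4 τ - 5 * PAt 5 τ) / 12)) τ := by
  have l (n : ℕ) (hn : n ≠ 0) := hasLogDerivAt_etaAt hn hτ
  have a4 := etaAt_ne_zero four_ne_zero hτ
  have a5 := etaAt_ne_zero (show 5 ≠ 0 by norm_num) hτ
  have h := (((l 1 (by norm_num)).mul (l 20 (by norm_num))).div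
    ((l 4 (by norm_num)).mul (l 5 (by norm_num))) (mul_ne_zero a4 a5)).pow 2
  rw [HasLogDerivAt] at h ⊢
  refine h.congr_deriv ?_
  rw [u]; push_cast; ring

lemma hasLogDerivAt_v {τ : ℂ} (hτ : 0 < τ.im) :
    HasLogDerivAt v (2 * Real.pi * Complex.I * ((2 * PAt 2 τ + 5 * PAt 5 τ + 20 * PAt 20 τ
      - PAt 1 τ - 4 * PAt 4 τ - 10 * PAt 10 τ) / 12)) τ := by
  have l (n : ℕ) (hn : n ≠ 0) := hasLogDerivAt_etaAt hn hτ
  have a1 := etaAt_ne_zero one_ne_zero hτ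
  have a4 := etaAt_ne_zero four_ne_zero hτ
  have a10 := etaAt_ne_zero (show 10 ≠ 0 by norm_num) hτ
  have h := ((((l 2 (by norm_num)).mul (l 5 (by norm_num))).mul (l 20 (by norm_num))).div
    (((l 1 (by norm_num)).mul (l 4 (by norm_num))).mul (l 10 (by norm_num)))
    (mul_ne_zero (mul_ne_zero a1 a4) a10)).pow 2
  rw [HasLogDerivAt] at h ⊢
  refine h.congr_deriv ?_
  rw [v]; push_cast; ring

lemma u_ne_zero {τ : ℂ} (hτ : 0 < τ.im) : u τ ≠ 0 := by
  simp [u, etaAt_ne_zero, hτ]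

lemma v_ne_zero {τ : ℂ} (hτ : 0 < τ.im) : v τ ≠ 0 := by
  simp [v, etaAt_ne_zero, hτ]

/-- The squares of `φ(q)` and `φ(q⁵)` are linear in `X` and `Y`, where `X² = zv`, `Y² = z/v`
and `XY = z`. -/
lemma exists_parametrization {τ : ℂ} (hτ : 0 < τ.im) :
    ∃ X Y : ℂ, X ≠ 0 ∧ Y ≠ 0 ∧ z τ = X * Y ∧ v τ = X / Y ∧
      (etaAt 2 τ ^ 5 / (etaAt 1 τ ^ 2 * etaAt 4 τ ^ 2)) ^ 2 = 5 * X + Y ∧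
      (etaAt 10 τ ^ 5 / (etaAt 5 τ ^ 2 * etaAt 20 τ ^ 2)) ^ 2 = X + Y := by
  have a1 := etaAt_ne_zero one_ne_zero hτ
  have a2 := etaAt_ne_zero two_ne_zero hτ
  have a4 := etaAt_ne_zero four_ne_zero hτ
  have a5 := etaAt_ne_zero (show 5 ≠ 0 by norm_num) hτ
  have a10 := etaAt_ne_zero (show 10 ≠ 0 by norm_num) hτ
  have a20 := etaAt_ne_zero (show 20 ≠ 0 by norm_num) hτ
  have hA := eta_identity_sub hτ
  have hB := eta_identity_sub_five hτ
  refine ⟨etaAt 2 τ ^ 2 * etaAt 5 τ * etaAt 20 τ / (etaAt 1 τ * etaAt 4 τ),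
    etaAt 1 τ * etaAt 4 τ * etaAt 10 τ ^ 2 / (etaAt 5 τ * etaAt 20 τ), by simp [a1, a2, a4, a5, a20],
    by simp [a1, a4, a5, a10, a20], ?_, ?_, by linear_combination (5 * hA + hB) / 4,
    by linear_combination (hA + hB) / 4⟩
  · rw [z]; field_simp
  · rw [v]; field_simp

/-- Put $r=uv$. The $\psi$ identities at $2\tau$ make $1-r$ and $1-5r$ eta quotients, and
$(1+5v)/(1+v)=\varphi(q)^2/\varphi(q^5)^2$ is one too, so the relation compares monomials in eta
functions. -/
lemma cubic_relation {τ : ℂ} (hτ : 0 < τ.im) :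
    (1 + 5 * v τ) * (u τ * v τ) * (1 - u τ * v τ) ^ 2 =
      (1 + v τ) * v τ ^ 2 * (1 - 5 * (u τ * v τ)) ^ 2 := by
  have a1 := etaAt_ne_zero one_ne_zero hτ
  have a2 := etaAt_ne_zero two_ne_zero hτ
  have a4 := etaAt_ne_zero four_ne_zero hτ
  have a5 := etaAt_ne_zero (show 5 ≠ 0 by norm_num) hτ
  have a10 := etaAt_ne_zero (show 10 ≠ 0 by norm_num) hτ
  have a20 := etaAt_ne_zero (show 20 ≠ 0 by norm_num) hτ
  have hG1 := eta_identity_psi (τ := (2 : ℕ) * τ) (by simpa using hτ)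
  have hG2 := eta_identity_psi_five (τ := (2 : ℕ) * τ) (by simpa using hτ)
  simp only [etaAt_nat_mul, Nat.reduceMul] at hG1 hG2
  obtain ⟨X, Y, hX, hY, -, hv, hs, ht⟩ := exists_parametrization hτ
  have hr : u τ * v τ = (etaAt 20 τ ^ 2 / etaAt 10 τ) ^ 2 / (etaAt 4 τ ^ 2 / etaAt 2 τ) ^ 2 := by
    rw [u, v]; field_simp
  have h1 : 1 - u τ * v τ = etaAt 4 τ * etaAt 10 τ ^ 3 / (etaAt 2 τ * etaAt 20 τ) /
      (etaAt 4 τ ^ 2 / etaAt 2 τ) ^ 2 := by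
    rw [hr, ← hG1, sub_div, div_self (by simp [a2, a4])]
  have h2 : 1 - 5 * (u τ * v τ) = etaAt 2 τ ^ 3 * etaAt 20 τ / (etaAt 4 τ * etaAt 10 τ) /
      (etaAt 4 τ ^ 2 / etaAt 2 τ) ^ 2 := by
    rw [hr, ← hG2, sub_div, mul_div_assoc, div_self (by simp [a2, a4])]
  have h3 : (etaAt 2 τ ^ 5 / (etaAt 1 τ ^ 2 * etaAt 4 τ ^ 2)) ^ 2 * (u τ * v τ) *
      (1 - u τ * v τ) ^ 2 = (etaAt 10 τ ^ 5 / (etaAt 5 τ ^ 2 * etaAt 20 τ ^ 2)) ^ 2 * v τ ^ 2 *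
      (1 - 5 * (u τ * v τ)) ^ 2 := by
    rw [h1, h2, hr, v]; field_simp
  rw [hs, ht] at h3
  have h4 : 1 + 5 * v τ = (5 * X + Y) / Y := by rw [hv]; field_simp; ring
  have h5 : 1 + v τ = (X + Y) / Y := by rw [hv]; field_simp; ring
  rw [h4, h5]
  linear_combination h3 / Y

/-- The algebraic relation between `u` and `v`. -/
lemma u_v_relation {τ : ℂ} (hτ : 0 < τ.im) : u τ + 1 / u τ = 1 / v τ + 5 * v τ + 4 := by
  have hu {τ : ℂ} (hτ : 0 < τ.im) : DifferentiableAt ℂ u τ := (hasLogDerivAt_u hτ).differentiableAt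
  have hv {τ : ℂ} (hτ : 0 < τ.im) : DifferentiableAt ℂ v τ := (hasLogDerivAt_v hτ).differentiableAt
  -- The difference of the two sides of `cubic_relation` factors as $f\cdot g$. Near the cusp $f$ is
  -- close to $-1$, so $g$ vanishes identically; dividing $g$ by $uv^2$ gives the claim.
  have key := eq_zero_of_mul_eq_zero (f := fun τ ↦ (1 + 5 * v τ) * (u τ * v τ) - (1 + v τ))
    (g := fun τ ↦ (u τ * v τ) ^ 2 + v τ ^ 2 - u τ * v τ * (1 + 4 * v τ + 5 * v τ ^ 2))
    (fun τ h ↦ by have := hu h; have := hv h; fun_prop)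
    (fun τ h ↦ by have := hu h; have := hv h; fun_prop)
    (fun τ h ↦ by linear_combination cubic_relation h) ?_ hτ
  · have h1 := u_ne_zero hτ
    have h2 := v_ne_zero hτ
    field_simp
    apply mul_left_cancel₀ h2
    linear_combination key
  · obtain ⟨σ, hσ, hu, hv⟩ := exists_norm_u_v_lt (ε := 1 / 10) (by norm_num)
    refine ⟨σ, hσ, fun h ↦ ?_⟩
    have h1 : (1 : ℂ) = (1 + 5 * v σ) * (u σ * v σ) - v σ := by linear_combination -h
    have h2 : ‖(1 + 5 * v σ) * (u σ * v σ) - v σ‖ ≤ (1 + 5 * ‖v σ‖) * (‖u σ‖ * ‖v σ‖) + ‖v σ‖ := by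
      refine (norm_sub_le _ _).trans ?_
      rw [norm_mul, norm_mul]
      gcongr
      refine (norm_add_le _ _).trans ?_
      simp
    rw [← h1, norm_one] at h2
    nlinarith [norm_nonneg (u σ), norm_nonneg (v σ), mul_nonneg (norm_nonneg (u σ)) (norm_nonneg (v σ)),
      mul_le_mul hu.le hv.le (norm_nonneg _) (by norm_num)]

/-- The logarithmic derivative of `u` in terms of `z` and `v`. -/
lemma eisenstein_eq_z_v {τ : ℂ} (hτ : 0 < τ.im) :
    (PAt 1 τ + 20 * PAt 20 τ - 4 * PAt 4 τ - 5 * PAt 5 τ) / 12 = z τ / v τ - 5 * z τ * v τ := by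
  obtain ⟨X, Y, hX, hY, hz, hv, hs, ht⟩ := exists_parametrization hτ
  have h1 := eisenstein_eq_phi_pow hτ
  have h2 := eisenstein_eq_phi_pow_five hτ
  rw [show 4 = 2 * 2 from rfl, pow_mul, hs] at h1
  rw [show 4 = 2 * 2 from rfl, pow_mul, ht] at h2
  have h3 : z τ / v τ = Y ^ 2 := by rw [hz, hv]; field_simp
  have h4 : 5 * z τ * v τ = 5 * X ^ 2 := by rw [hz, hv]; field_simp
  rw [h3, h4]
  norm_num at h1 h2
  linear_combination -h1 / 12 + 5 * h2 / 12

/-- Differentiating `u_v_relation` gives $(u-1/u)\,u'/u=(5v-1/v)\,v'/v$. As $u'/u$ is $2\pi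
i\,z(1/v-5v)$, both sides contain $5v-1/v$. It may vanish at points, so it is kept here and removed
by analyticity afterwards. -/
lemma mul_eisenstein_sub_eq_zero {τ : ℂ} (hτ : 0 < τ.im) :
    (5 * v τ ^ 2 - 1) * ((2 * PAt 2 τ + 5 * PAt 5 τ + 20 * PAt 20 τ - PAt 1 τ - 4 * PAt 4 τ
      - 10 * PAt 10 τ) / 12 - (z τ / u τ - z τ * u τ)) = 0 := by
  have h1 := u_ne_zero hτ
  have h2 := v_ne_zero hτ
  have du := hasLogDerivAt_u hτ
  have dv := hasLogDerivAt_v hτ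
  rw [eisenstein_eq_z_v hτ, HasLogDerivAt] at du
  rw [HasLogDerivAt] at dv
  have d1 := du.fun_add (du.fun_inv h1)
  have d2 := ((dv.fun_inv h2).fun_add (dv.const_mul 5)).add_const 4
  have h : (fun x ↦ u x + (u x)⁻¹) =ᶠ[𝓝 τ] fun x ↦ (v x)⁻¹ + 5 * v x + 4 := by
    filter_upwards [UpperHalfPlane.isOpen_upperHalfPlaneSet.mem_nhds hτ] with x hx
    simpa only [one_div] using u_v_relation hx
  have d3 := d1.unique (d2.congr_of_eventuallyEq h)
  generalize (2 * PAt 2 τ + 5 * PAt 5 τ + 20 * PAt 20 τ - PAt 1 τ - 4 * PAt 4 τ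
    - 10 * PAt 10 τ) / 12 = W at *
  have h3 := Complex.two_pi_I_ne_zero
  generalize 2 * (Real.pi : ℂ) * Complex.I = c at *
  generalize u τ = a at *
  generalize v τ = b at *
  generalize z τ = w at *
  clear du dv d1 d2 h
  apply mul_left_cancel₀ h3
  field_simp at d3 ⊢
  linear_combination -d3

lemma differentiableAt_z {τ : ℂ} (hτ : 0 < τ.im) : DifferentiableAt ℂ z τ := by
  have h2 := differentiableAt_etaAt two_ne_zero hτ
  have h10 := differentiableAt_etaAt (show 10 ≠ 0 by norm_num) hτ
  exact (h2.fun_pow 2).fun_mul (h10.fun_pow 2)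

/-- The logarithmic derivative of `v` in terms of `z` and `u`. -/
lemma eisenstein_eq_z_u {τ : ℂ} (hτ : 0 < τ.im) :
    (2 * PAt 2 τ + 5 * PAt 5 τ + 20 * PAt 20 τ - PAt 1 τ - 4 * PAt 4 τ - 10 * PAt 10 τ) / 12 =
      z τ / u τ - z τ * u τ := by
  have hu (τ : ℂ) (hτ : 0 < τ.im) : DifferentiableAt ℂ u τ := (hasLogDerivAt_u hτ).differentiableAt
  have hv (τ : ℂ) (hτ : 0 < τ.im) : DifferentiableAt ℂ v τ := (hasLogDerivAt_v hτ).differentiableAt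
  have hz (τ : ℂ) (hτ : 0 < τ.im) : DifferentiableAt ℂ z τ :=
    differentiableAt_z hτ
  have hf (τ : ℂ) (h : 0 < τ.im) : DifferentiableAt ℂ (fun τ ↦ 5 * v τ ^ 2 - 1) τ := by
    have := hv τ h
    fun_prop
  have hg (τ : ℂ) (h : 0 < τ.im) : DifferentiableAt ℂ (fun τ ↦ (2 * PAt 2 τ + 5 * PAt 5 τ
      + 20 * PAt 20 τ - PAt 1 τ - 4 * PAt 4 τ - 10 * PAt 10 τ) / 12
      - (z τ / u τ - z τ * u τ)) τ := by
    have p (l : ℕ) (hl : l ≠ 0) := differentiableAt_PAt hl h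
    have p1 := p 1 (by norm_num)
    have p2 := p 2 (by norm_num)
    have p4 := p 4 (by norm_num)
    have p5 := p 5 (by norm_num)
    have p10 := p 10 (by norm_num)
    have p20 := p 20 (by norm_num)
    clear p
    have hq := ((hz τ h).fun_div (hu τ h) (u_ne_zero h)).fun_sub ((hz τ h).fun_mul (hu τ h))
    refine DifferentiableAt.fun_sub ?_ hq
    clear hq hu hv hz hf
    generalize PAt 1 = F1 at *
    generalize PAt 2 = F2 at *
    generalize PAt 4 = F4 at *
    generalize PAt 5 = F5 at *
    generalize PAt 10 = F10 at *
    generalize PAt 20 = F20 at *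
    fun_prop
  have hne : ∃ τ : ℂ, 0 < τ.im ∧ 5 * v τ ^ 2 - 1 ≠ 0 := by
    obtain ⟨σ, hσ, -, hv⟩ := exists_norm_u_v_lt (ε := 1 / 10) (by norm_num)
    refine ⟨σ, hσ, fun h ↦ ?_⟩
    have h1 : (1 : ℂ) = 5 * v σ ^ 2 := by linear_combination -h
    have h2 := congrArg norm h1
    rw [norm_mul, norm_pow, norm_one, Complex.norm_ofNat] at h2
    nlinarith [norm_nonneg (v σ)]
  exact sub_eq_zero.mp
    (eq_zero_of_mul_eq_zero hf hg (fun x hx ↦ mul_eisenstein_sub_eq_zero hx) hne hτ)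

end Level20

end

theorem mainTheorem7 (τ : UpperHalfPlane) :
    Level20.z τ * Level20.u τ =
        (1 / 72 : ℂ) * (Level20.PAt 1 τ - 6 * Level20.PAt 2 τ + 20 * Level20.PAt 4 τ
          - 25 * Level20.PAt 5 τ + 30 * Level20.PAt 10 τ - 20 * Level20.PAt 20 τ)
        + (1 / 3 : ℂ) * Level20.z τ ∧
    Level20.z τ / Level20.u τ =
        (1 / 72 : ℂ) * (-5 * Level20.PAt 1 τ + 6 * Level20.PAt 2 τ - 4 * Level20.PAt 4 τ
          + 5 * Level20.PAt 5 τ - 30 * Level20.PAt 10 τ + 100 * Level20.PAt 20 τ)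
        + (1 / 3 : ℂ) * Level20.z τ ∧
    Level20.z τ * Level20.v τ =
        (1 / 72 : ℂ) * (-Level20.PAt 1 τ + 4 * Level20.PAt 4 τ + Level20.PAt 5 τ
          - 4 * Level20.PAt 20 τ)
        - (1 / 3 : ℂ) * Level20.z τ ∧
    Level20.z τ / Level20.v τ =
        (1 / 72 : ℂ) * (Level20.PAt 1 τ - 4 * Level20.PAt 4 τ - 25 * Level20.PAt 5 τ
          + 100 * Level20.PAt 20 τ)
        - (5 / 3 : ℂ) * Level20.z τ := by
  have hτ : 0 < (τ : ℂ).im := τ.2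
  generalize (τ : ℂ) = σ at *
  obtain ⟨X, Y, hX, hY, hz, hv, hs, ht⟩ := Level20.exists_parametrization hτ
  have h1 := Level20.eisenstein_eq_phi_pow hτ
  have h2 := Level20.eisenstein_eq_phi_pow_five hτ
  rw [pow_mul _ 2 2, hs] at h1
  rw [pow_mul _ 2 2, ht] at h2
  have h3 := Level20.eisenstein_eq_z_u hτ
  -- The sum of $zu$ and $z/u$ is found here, their difference is `h3`; half the sum and half the
  -- difference give the first two formulas.
  have h4 : Level20.z σ * Level20.u σ + Level20.z σ / Level20.u σ =
      Y ^ 2 + 5 * X ^ 2 + 4 * (X * Y) := by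
    have := Level20.u_v_relation hτ
    calc _ = Level20.z σ * (Level20.u σ + 1 / Level20.u σ) := by ring
      _ = _ := by rw [this, hz, hv]; field_simp
  have h5 : Level20.z σ * Level20.v σ = X ^ 2 := by rw [hz, hv]; field_simp
  have h6 : Level20.z σ / Level20.v σ = Y ^ 2 := by rw [hz, hv]; field_simp
  rw [h5, h6]
  refine ⟨?_, ?_, ?_, ?_⟩
  · rw [hz] at *
    linear_combination h4 / 2 - h1 / 72 * 2 - h2 / 72 * 10 + h3 / 2
  · rw [hz] at *
    linear_combination h4 / 2 - h1 / 72 * 2 - h2 / 72 * 10 - h3 / 2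
  · rw [hz]; linear_combination -h1 / 72 + h2 / 72
  · rw [hz]; linear_combination h1 / 72 - 25 * h2 / 72
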